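/- Let $\xi\ge 1$ be an integer and $a>0$. Tile the Euclidean plane by regular hexagons of apothem $a$ (the tessellation $\{6,3\}$, with edge length $l=2a/\sqrt3$), and let $\mathbb{T}$ be the flat torus obtained by identifying opposite sides of a parallelogram with angle $\pi/3$ whose sides have length $L=2\xi a$ and point from the centre of one hexagon towards the centres of two adjacent hexagons. The tessellation descends to $\mathbb{T}$; let $V,E,F$ be its sets of vertices, edges and faces there, and let $\{3,6\}$ denote the dual tessellation of $\mathbb{T}$. Place a qubit on each edge. For $c\in\mathbb{Z}_2^{E}$ put $X_c=\bigotimes_e X^{c_e}$ and $Z_c=\bigotimes_e Z^{c_e}$. For each face $f$ let $X_f=X_{\partial f}$, where $\partial f$ is the mod 2 boundary of $f$, and for each vertex $v$ let $Z_v=Z_{\delta v}$, where $\delta v$ is the mod 2 coboundary of $v$. Let $Q\subset(\mathbb{C}^2)^{\otimes E}$ be the space of vectors fixed by all $X_f$ and all $Z_v$. Then $Q$ is an asymmetric quantum code with parameters $$[[\,3\xi^2,\;2,\;d_z/d_x\,]]=[[\,3\xi^2,\;2,\;\xi\,/\,\lceil\xi\sqrt3\,\rceil\,]],$$ that is, $|E|=3\xi^2$,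 $\dim Q=2^2$, and some recovery channel corrects on $Q$ all errors $X_sZ_t$, $s,t\in\mathbb{Z}_2^E$, in which $s$ has at most $\lfloor(d_x-1)/2\rfloor$ and $t$ at most $\lfloor(d_z-1)/2\rfloor$ nonzero entries. Moreover, the shortest homologically nontrivial (mod 2) cycle of the dual tessellation $\{3,6\}$ has exactly $\xi$ edges, and every homologically nontrivial cycle of $\{6,3\}$ has at least $\lceil\xi\sqrt3\,\rceil$ edges. -/

import Mathlib

noncomputable section

namespace HexTorus

/-! ### Quantum codes on a register of qubits indexed by `E` -/

/-- Computational basis labels of a register of qubits indexed by `E`. -/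
abbrev Label (E : Type) := E → ZMod 2

/-- The bit-flip operator `X_a`, `X_a |x⟩ = |x + a⟩`. -/
def opX {E : Type} [Fintype E] [DecidableEq E] (a : Label E) :
    Matrix (Label E) (Label E) ℂ :=
  Matrix.of fun y x => if y = x + a then 1 else 0

/-- The phase-shift operator `Z_b`, `Z_b |x⟩ = ∏ᵢ (-1)^(bᵢ xᵢ) |x⟩`. -/
def opZ {E : Type} [Fintype E] [DecidableEq E] (b : Label E) :
    Matrix (Label E) (Label E) ℂ :=
  Matrix.diagonal fun x => ∏ i, (-1 : ℂ) ^ (b i * x i).val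

/-- The subspace `Q` corrects every error in `errs`: there is one quantum channel (given by Kraus
operators `R 0, …, R (m - 1)`) that restores every state vector of `Q` after every error. -/
def Corrects {B : Type} [Fintype B] [DecidableEq B] (Q : Submodule ℂ (B → ℂ))
    (errs : Set (Matrix B B ℂ)) : Prop :=
  ∃ (m : ℕ) (R : Fin m → Matrix B B ℂ),
    ∑ j, (R j).conjTranspose * R j = 1 ∧
    ∀ A ∈ errs, ∀ ψ ∈ Q,
      ∑ j, Matrix.vecMulVec ((R j).mulVec (A.mulVec ψ)) (star ((R j).mulVec (A.mulVec ψ))) =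
        Matrix.vecMulVec ψ (star ψ)

/-- `Q` is an asymmetric quantum error-correcting code with parameters `[[n, k, dz / dx]]`: a
`2 ^ k`-dimensional space of states of `n` qubits that corrects all errors `X_a Z_b` with at most
`⌊(dx - 1) / 2⌋` bit flips and at most `⌊(dz - 1) / 2⌋` phase shifts. -/
structure IsAsymmetricCode {E : Type} [Fintype E] [DecidableEq E]
    (Q : Submodule ℂ (Label E → ℂ)) (n k dz dx : ℕ) : Prop where
  length_eq : Fintype.card E = n
  dim_eq : Module.finrank ℂ Q = 2 ^ k
  corrects : Corrects Q {A | ∃ a b : Label E, hammingNorm a ≤ (dx - 1) / 2 ∧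
    hammingNorm b ≤ (dz - 1) / 2 ∧ A = opX a * opZ b}

/-! ### Topological codes

A tessellation of a closed surface enters through its mod 2 boundary matrices
`∂₁ : C₁ → C₀` and `∂₂ : C₂ → C₁`. The dual tessellation (a vertex in each face, an edge across each
edge, a face around each vertex) has boundary matrices `∂₂ᵀ` and `∂₁ᵀ`. -/

/-- The topological code: the states fixed by the face operators `X_f` (one factor `X` for each edge
on the border of `f`) and by the vertex operators `Z_v` (one factor `Z` for each edge end at `v`). -/
def topologicalCode {V E F : Type} [Fintype E] [DecidableEq E]
    (bd₁ : Matrix V E (ZMod 2)) (bd₂ : Matrix E F (ZMod 2)) : Submodule ℂ (Label E → ℂ) where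
  carrier := {ψ | (∀ f : F, (opX fun e => bd₂ e f).mulVec ψ = ψ) ∧
    ∀ v : V, (opZ fun e => bd₁ v e).mulVec ψ = ψ}
  add_mem' := by
    rintro ψ φ ⟨h₁, h₂⟩ ⟨h₃, h₄⟩
    exact ⟨fun f => by rw [Matrix.mulVec_add, h₁, h₃], fun v => by rw [Matrix.mulVec_add, h₂, h₄]⟩
  zero_mem' := ⟨fun f => Matrix.mulVec_zero _, fun v => Matrix.mulVec_zero _⟩
  smul_mem' := by
    rintro z ψ ⟨h₁, h₂⟩
    exact ⟨fun f => by rw [Matrix.mulVec_smul, h₁], fun v => by rw [Matrix.mulVec_smul, h₂]⟩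

/-- The homologically nontrivial 1-cycles, `Z₁ \ B₁`. -/
def nontrivialCycles {V E F : Type} [Fintype E] [Fintype F]
    (bd₁ : Matrix V E (ZMod 2)) (bd₂ : Matrix E F (ZMod 2)) : Set (E → ZMod 2) :=
  {c | bd₁.mulVec c = 0 ∧ ¬ ∃ s : F → ZMod 2, bd₂.mulVec s = c}

/-- The numbers of edges of the homologically nontrivial 1-cycles. -/
def nontrivialCycleLengths {V E F : Type} [Fintype E] [Fintype F]
    (bd₁ : Matrix V E (ZMod 2)) (bd₂ : Matrix E F (ZMod 2)) : Set ℕ :=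
  hammingNorm '' nontrivialCycles bd₁ bd₂

/-! ### The hexagonal tessellation of the plane `ℂ` by regular hexagons of apothem `a` -/

/-- The unit vector at angle `π / 3`. -/
def unit60 : ℂ := Complex.exp ((Real.pi / 3 : ℝ) * Complex.I)

/-- The centres of the hexagons: adjacent centres are at distance `2 a`. -/
def centres (a : ℝ) : AddSubgroup ℂ :=
  AddSubgroup.closure {((2 * a : ℝ) : ℂ), ((2 * a : ℝ) : ℂ) * unit60}

/-- The corner at angle `π / 6 + k π / 3` of the hexagon with centre `c` and apothem `a`; the edge
length (and circumradius) of this hexagon is `2 a / √3`. -/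
def corner (a : ℝ) (c : ℂ) (k : ℕ) : ℂ :=
  c + ((2 * a / Real.sqrt 3 : ℝ) : ℂ) *
    Complex.exp ((Real.pi / 6 + k * (Real.pi / 3) : ℝ) * Complex.I)

/-- The `k`-th side of the hexagon with centre `c`, given by its two end points. -/
def hexSide (a : ℝ) (c : ℂ) (k : Fin 6) : Sym2 ℂ :=
  s(corner a c k, corner a c ((k : ℕ) + 1))

/-- The edges of the hexagonal tessellation of the plane. -/
def PlaneEdge (a : ℝ) : Type :=
  {e : Sym2 ℂ // ∃ c ∈ centres a, ∃ k : Fin 6, e = hexSide a c k}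

/-! ### The flat torus and its hexagonal tessellation -/

/-- The lattice of the flat torus whose fundamental parallelogram has both side lengths `L` and
angle `π / 3`. -/
def torusLattice (L : ℝ) : AddSubgroup ℂ :=
  AddSubgroup.closure {(L : ℂ), (L : ℂ) * unit60}

/-- The lattice of the torus with `L = 2 ξ a`. -/
abbrev lattice (a : ℝ) (ξ : ℕ) : AddSubgroup ℂ := torusLattice (2 * ξ * a)

/-- The vertices of the tessellation of the torus, as points of the torus. -/
def TorusVertex (a : ℝ) (ξ : ℕ) : Type :=
  {p : ℂ ⧸ lattice a ξ // ∃ c ∈ centres a, ∃ k : Fin 6, p = (corner a c k : ℂ)}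

/-- Two edges in the plane give the same edge of the torus if a translation by a vector of the
lattice carries one to the other. -/
def edgeSetoid (a : ℝ) (ξ : ℕ) : Setoid (PlaneEdge a) where
  r e e' := ∃ t ∈ lattice a ξ, e'.1 = e.1.map (t + ·)
  iseqv :=
    { refl := fun e => ⟨0, zero_mem _, by simp⟩
      symm := by
        rintro e e' ⟨t, ht, h⟩
        exact ⟨-t, neg_mem ht, by simp [h, Sym2.map_map]⟩
      trans := by
        rintro e e' e'' ⟨t, ht, h⟩ ⟨u, hu, h'⟩
        exact ⟨u + t, add_mem hu ht, by simp [h, h', Sym2.map_map, add_assoc]⟩ }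

/-- The edges of the tessellation of the torus. -/
def TorusEdge (a : ℝ) (ξ : ℕ) : Type := Quotient (edgeSetoid a ξ)

/-- The hexagonal faces of the tessellation of the torus, recorded by their centres. -/
def TorusFace (a : ℝ) (ξ : ℕ) : Type :=
  centres a ⧸ (lattice a ξ).addSubgroupOf (centres a)

/-- The edge of the torus that is the image of the `k`-th side of the hexagon with centre `c`. -/
def torusSide (a : ℝ) (ξ : ℕ) (c : centres a) (k : Fin 6) : TorusEdge a ξ :=
  Quotient.mk (edgeSetoid a ξ) ⟨hexSide a c k, c, c.2, k, rfl⟩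

theorem finite_torusFace (a : ℝ) (ξ : ℕ) [NeZero ξ] : Finite (TorusFace a ξ) := by
  have h0 : (0 : ℤ) < ξ := by exact_mod_cast Nat.pos_of_ne_zero (NeZero.ne ξ)
  have mem : ∀ i j : ℤ, i • ((2 * a : ℝ) : ℂ) + j • (((2 * a : ℝ) : ℂ) * unit60) ∈ centres a :=
    fun i j => AddSubgroup.mem_closure_pair.2 ⟨i, j, rfl⟩
  let g : Fin ξ × Fin ξ → TorusFace a ξ := fun p => QuotientAddGroup.mk ⟨_, mem p.1 p.2⟩
  refine Finite.of_surjective g fun q => ?_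
  induction q using QuotientAddGroup.induction_on with
  | H c =>
    obtain ⟨c, hc⟩ := c
    obtain ⟨i, j, rfl⟩ := AddSubgroup.mem_closure_pair.1 hc
    have hi := Int.emod_nonneg i h0.ne'
    have hj := Int.emod_nonneg j h0.ne'
    have hi' := Int.emod_lt_of_pos i h0
    have hj' := Int.emod_lt_of_pos j h0
    refine ⟨(⟨(i % ξ).toNat, by omega⟩, ⟨(j % ξ).toNat, by omega⟩), ?_⟩
    refine QuotientAddGroup.eq.2 (AddSubgroup.mem_addSubgroupOf.2 ?_)
    refine AddSubgroup.mem_closure_pair.2 ⟨i / ξ, j / ξ, ?_⟩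
    have ei : (i : ℂ) = (i % ξ : ℤ) + ξ * (i / ξ : ℤ) := by
      exact_mod_cast (Int.emod_add_mul_ediv i ξ).symm
    have ej : (j : ℂ) = (j % ξ : ℤ) + ξ * (j / ξ : ℤ) := by
      exact_mod_cast (Int.emod_add_mul_ediv j ξ).symm
    have ti : (((i % ξ).toNat : ℤ) : ℂ) = (i % ξ : ℤ) := by rw [Int.toNat_of_nonneg hi]
    have tj : (((j % ξ).toNat : ℤ) : ℂ) = (j % ξ : ℤ) := by rw [Int.toNat_of_nonneg hj]
    simp only [zsmul_eq_mul, AddSubgroup.coe_add, AddSubgroup.coe_neg, ti, tj]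
    rw [ei, ej]
    push_cast
    ring

theorem finite_torusEdge (a : ℝ) (ξ : ℕ) [NeZero ξ] : Finite (TorusEdge a ξ) := by
  have := finite_torusFace a ξ
  let g : TorusFace a ξ × Fin 6 → TorusEdge a ξ := fun p => torusSide a ξ (Quotient.out p.1) p.2
  refine Finite.of_surjective g fun q => ?_
  induction q using Quotient.inductionOn with
  | h e =>
    obtain ⟨e, c, hc, k, rfl⟩ := e
    refine ⟨(QuotientAddGroup.mk ⟨c, hc⟩, k), Quotient.sound ?_⟩
    obtain ⟨h, hh⟩ := QuotientAddGroup.mk_out_eq_add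
      ((lattice a ξ).addSubgroupOf (centres a)) ⟨c, hc⟩
    refine ⟨-(h : centres a), neg_mem (AddSubgroup.mem_addSubgroupOf.1 h.2), ?_⟩
    have := congrArg (Subtype.val) hh
    simp only [AddSubgroup.coe_add] at this
    simp only [hexSide, corner, this, Sym2.map_mk]
    congr 1 <;> ring_nf

theorem finite_torusVertex (a : ℝ) (ξ : ℕ) [NeZero ξ] : Finite (TorusVertex a ξ) := by
  have := finite_torusFace a ξ
  let g : TorusFace a ξ × Fin 6 → TorusVertex a ξ := fun p =>
    ⟨(corner a (Quotient.out p.1 : centres a) p.2 : ℂ), _, (Quotient.out p.1).2, p.2, rfl⟩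
  refine Finite.of_surjective g fun q => ?_
  obtain ⟨_, c, hc, k, rfl⟩ := q
  refine ⟨(QuotientAddGroup.mk ⟨c, hc⟩, k), Subtype.ext (QuotientAddGroup.eq.2 ?_)⟩
  obtain ⟨h, hh⟩ := QuotientAddGroup.mk_out_eq_add
    ((lattice a ξ).addSubgroupOf (centres a)) ⟨c, hc⟩
  have := congrArg (Subtype.val) hh
  simp only [AddSubgroup.coe_add] at this
  have h2 := neg_mem (AddSubgroup.mem_addSubgroupOf.1 h.2)
  convert h2 using 1
  simp only [corner, this]
  ring

instance (a : ℝ) (ξ : ℕ) [NeZero ξ] : Fintype (TorusFace a ξ) :=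
  have := finite_torusFace a ξ
  Fintype.ofFinite _

instance (a : ℝ) (ξ : ℕ) [NeZero ξ] : Fintype (TorusEdge a ξ) :=
  have := finite_torusEdge a ξ
  Fintype.ofFinite _

instance (a : ℝ) (ξ : ℕ) [NeZero ξ] : Fintype (TorusVertex a ξ) :=
  have := finite_torusVertex a ξ
  Fintype.ofFinite _

instance (a : ℝ) (ξ : ℕ) : DecidableEq (TorusEdge a ξ) := Classical.decEq _

/-- The mod 2 boundary matrix `∂₁` of the tessellation of the torus: the entry at `(v, e)` is the
number of end points of a lift of `e` to the plane that project to `v`. -/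
def boundary₁ (a : ℝ) (ξ : ℕ) : Matrix (TorusVertex a ξ) (TorusEdge a ξ) (ZMod 2) :=
  Matrix.of fun v e =>
    (Set.ncard {z : ℂ | z ∈ (Quotient.out e).1 ∧ (z : ℂ ⧸ lattice a ξ) = v.1} : ZMod 2)

/-- The mod 2 boundary matrix `∂₂` of the tessellation of the torus: the entry at `(e, f)` is the
number of sides of a lift of the hexagon `f` to the plane that project to `e`. -/
def boundary₂ (a : ℝ) (ξ : ℕ) : Matrix (TorusEdge a ξ) (TorusFace a ξ) (ZMod 2) :=
  Matrix.of fun e f =>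
    ((Finset.univ.filter fun k : Fin 6 => torusSide a ξ (Quotient.out f) k = e).card : ZMod 2)

end HexTorus

end

/-! Write `K` for the kernel of `∂₁` and `B` for the image of `∂₂`. The vertex operators force a
code state to be supported on `K`, and the face operators force it to be invariant under translation
by `B` (`mem_topologicalCode_iff`). Hence the dimension is the number of classes in `K / B`, the
first mod 2 homology of the torus, which has four elements.

Error correction is the CSS argument (`corrects_of_distances`). Bit flips are known modulo `K` and
phase flips modulo the orthogonal complement of `B`. Decoding to a lightest element of each class
leaves a residual error lighter than the distance. This residual is homologically trivial, so it
acts on the code by a phase.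

The distances are found on a `ξ × ξ` grid with two vertices, three edges and one face per cell. A
cycle of the hexagons is a closed cochain on the dual triangulation, classified by two periods
(`exists_boundary_of_periods_eq_zero`). A nontrivial cycle has odd intersection with every line of
faces in at least two of the three directions. Each direction has `ξ` lines, so the cycle has at
least `2ξ` edges, which exceeds the required bound (`two_mul_le_of_nontrivial_cycle`). A nontrivial
dual cycle must meet each of `ξ` disjoint homologous hexagonal cycles
(`le_of_nontrivial_dual_cycle`), and a straight line of `ξ` faces attains this bound.

Coordinates in the triangular lattice containing all centres and vertices identify the geometric
boundary matrices with those of the grid (`boundary₁_eq`, `boundary₂_eq`). -/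

noncomputable section

namespace HexTorus

/-! ### Recovery for CSS codes -/

/-- The additive character of `ZMod 2`. -/
def sgn (u : ZMod 2) : ℂ := (-1) ^ u.val

theorem sgn_zero : sgn 0 = 1 := by simp [sgn]

theorem sgn_one : sgn 1 = -1 := by
  have : (1 : ZMod 2).val = 1 := rfl
  simp [sgn, this]

theorem zmod_two_eq_zero_or_one (u : ZMod 2) : u = 0 ∨ u = 1 := by
  revert u; decide

theorem sgn_add (u v : ZMod 2) : sgn (u + v) = sgn u * sgn v := by
  have h : (1 + 1 : ZMod 2) = 0 := rfl
  rcases zmod_two_eq_zero_or_one u with rfl | rfl <;>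
  rcases zmod_two_eq_zero_or_one v with rfl | rfl <;> simp [h, sgn_zero, sgn_one]

theorem sgn_neg (u : ZMod 2) : sgn (-u) = sgn u := by rw [ZMod.neg_eq_self_mod_two]

theorem sgn_sub (u v : ZMod 2) : sgn (u - v) = sgn u * sgn v := by
  rw [sub_eq_add_neg, sgn_add, sgn_neg]

theorem sgn_mul_self (u : ZMod 2) : sgn u * sgn u = 1 := by
  rcases zmod_two_eq_zero_or_one u with rfl | rfl <;> simp [sgn_zero, sgn_one]

theorem star_sgn (u : ZMod 2) : star (sgn u) = sgn u := by
  rcases zmod_two_eq_zero_or_one u with rfl | rfl <;> simp [sgn_zero, sgn_one]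

theorem sgn_sum {ι : Type*} (s : Finset ι) (f : ι → ZMod 2) :
    sgn (∑ i ∈ s, f i) = ∏ i ∈ s, sgn (f i) := by
  classical
  induction s using Finset.induction_on with
  | empty => simp [sgn_zero]
  | insert i s hi ih => rw [Finset.sum_insert hi, Finset.prod_insert hi, sgn_add, ih]

section Register

variable {E : Type}

/-- The states supported on `K` and invariant under `B` form a space whose dimension is the number
of classes of `K` modulo `B`, here enumerated by `φ`. -/
theorem finrank_of_classes (K B : Submodule (ZMod 2) (Label E)) {H : Type*} [AddGroup H] [Fintype H]
    (hBK : B ≤ K) (φ : Label E →+ H) (hker : ∀ x ∈ K, φ x = 0 ↔ x ∈ B)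
    (hsurj : ∀ t, ∃ x ∈ K, φ x = t) (Q : Submodule ℂ (Label E → ℂ))
    (hQ : ∀ ψ, ψ ∈ Q ↔ (∀ x, x ∉ K → ψ x = 0) ∧ ∀ x, ∀ g ∈ B, ψ (x + g) = ψ x) :
    Module.finrank ℂ Q = Fintype.card H := by
  classical
  choose σ hσK hσ using hsurj
  have hφB : ∀ x, ∀ g ∈ B, φ (x + g) = φ x := fun x g hg => by
    rw [map_add, (hker g (hBK hg)).2 hg, add_zero]
  let L : (H → ℂ) ≃ₗ[ℂ] Q :=
    { toFun := fun f => ⟨fun x => if x ∈ K then f (φ x) else 0, (hQ _).2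
        ⟨fun x hx => if_neg hx, fun x g hg => by
          simp only [hφB x g hg, Submodule.add_mem_iff_left K (hBK hg)]⟩⟩
      map_add' := fun f g => by
        ext x
        by_cases hx : x ∈ K <;> simp [hx]
      map_smul' := fun z f => by
        ext x
        by_cases hx : x ∈ K <;> simp [hx]
      invFun := fun ψ t => ψ.1 (σ t)
      left_inv := fun f => by
        funext t
        simp [hσK, hσ]
      right_inv := fun ψ => by
        ext x
        obtain ⟨h1, h2⟩ := (hQ _).1 ψ.2
        by_cases hx : x ∈ K
        · simp only [hx, if_true]
          have h3 : σ (φ x) - x ∈ B := by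
            rw [← hker _ (sub_mem (hσK _) hx), map_sub, hσ, sub_self]
          have h4 := h2 x _ h3
          rwa [add_sub_cancel] at h4
        · simp [hx, h1 x hx] }
  rw [← L.finrank_eq, Module.finrank_fintype_fun_eq_card]

variable [Fintype E]

/-- The vectors orthogonal to a submodule for the standard bilinear form. -/
def dotPerp (S : Submodule (ZMod 2) (Label E)) : Submodule (ZMod 2) (Label E) where
  carrier := {w | ∀ g ∈ S, w ⬝ᵥ g = 0}
  add_mem' := by
    intro u v hu hv g hg
    rw [add_dotProduct, hu g hg, hv g hg, add_zero]
  zero_mem' := fun g _ => zero_dotProduct g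
  smul_mem' := by
    intro z u hu g hg
    rw [smul_dotProduct, hu g hg, smul_zero]

theorem mem_dotPerp {S : Submodule (ZMod 2) (Label E)} {w : Label E} :
    w ∈ dotPerp S ↔ ∀ g ∈ S, w ⬝ᵥ g = 0 := Iff.rfl

/-- Coset leaders: the decoder guesses the lightest error compatible with a syndrome. -/
theorem exists_min_weight_representative (S : Submodule (ZMod 2) (Label E)) :
    ∃ r : Label E → Label E, ∀ v, r v - v ∈ S ∧
      ∀ w, v - w ∈ S → hammingNorm (r v) ≤ hammingNorm w := by
  have h : ∀ v : Label E, ∃ u, u - v ∈ S ∧ ∀ w, v - w ∈ S → hammingNorm u ≤ hammingNorm w := by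
    intro v
    obtain ⟨u, hu, hmin⟩ := exists_minimalFor_of_wellFoundedLT (fun u => u - v ∈ S)
      (fun u : Label E => hammingNorm u) ⟨v, by simp⟩
    refine ⟨u, hu, fun w hw => ?_⟩
    by_contra hlt
    exact hlt (hmin (show w - v ∈ S by simpa using neg_mem hw) (not_le.1 hlt).le)
  choose r hr using h
  exact ⟨r, hr⟩

/-- Triangle inequality. Positivity of `d` matters because the subtraction is truncated: at `d = 0`
the strict inequality fails. -/
theorem hammingNorm_sub_lt {d : ℕ} (hd : 0 < d) {u v : Label E}
    (hu : hammingNorm u ≤ (d - 1) / 2) (hv : hammingNorm v ≤ (d - 1) / 2) :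
    hammingNorm (u - v) < d := by
  have h1 := hammingDist_triangle u 0 v
  have h2 : hammingDist u v = hammingNorm (u - v) := by
    simp only [hammingDist, hammingNorm, Pi.sub_apply, sub_ne_zero]
  rw [h2, hammingDist_zero_right, hammingDist_zero_left] at h1
  omega

variable [DecidableEq E]

theorem opX_mulVec (a : Label E) (ψ : Label E → ℂ) (y : Label E) :
    (opX a).mulVec ψ y = ψ (y - a) := by
  simp only [Matrix.mulVec, dotProduct, opX, Matrix.of_apply, ite_mul, one_mul, zero_mul]
  rw [Finset.sum_eq_single (y - a)]
  · simp
  · intro x _ hx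
    rw [if_neg]
    rintro rfl
    exact hx (by simp)
  · simp

theorem opZ_mulVec (b : Label E) (ψ : Label E → ℂ) (y : Label E) :
    (opZ b).mulVec ψ y = sgn (b ⬝ᵥ y) * ψ y := by
  rw [opZ, Matrix.mulVec_diagonal, dotProduct, sgn_sum]
  rfl

-- Orthogonality of characters: if some `g₀` in `S` pairs to `1` with `w`, translation by `g₀`
-- reverses the sign of every term, so the sum vanishes.
open scoped Classical in
theorem sum_sgn_submodule (S : Submodule (ZMod 2) (Label E)) (w : Label E) :
    ∑ g : S, sgn (w ⬝ᵥ (g : Label E)) = if w ∈ dotPerp S then (Fintype.card S : ℂ) else 0 := by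
  split_ifs with h
  · rw [Finset.sum_congr rfl fun g _ => by rw [h g g.2, sgn_zero]]
    simp
  · rw [mem_dotPerp] at h
    push Not at h
    obtain ⟨g₀, hg₀, hw⟩ := h
    have h1 : w ⬝ᵥ g₀ = 1 := (zmod_two_eq_zero_or_one _).resolve_left hw
    have h2 : ∑ g : S, sgn (w ⬝ᵥ (g : Label E)) = - ∑ g : S, sgn (w ⬝ᵥ (g : Label E)) := by
      rw [← Finset.sum_neg_distrib,
        ← Equiv.sum_comp (Equiv.addRight (⟨g₀, hg₀⟩ : S)) fun g : S => sgn (w ⬝ᵥ (g : Label E))]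
      refine Finset.sum_congr rfl fun g _ => ?_
      simp [dotProduct_add, sgn_add, h1, sgn_one]
    exact self_eq_neg.mp h2

open scoped Classical in
theorem sum_sgn (x : Label E) :
    ∑ w : Label E, sgn (w ⬝ᵥ x) = if x = 0 then (Fintype.card (Label E) : ℂ) else 0 := by
  have h := sum_sgn_submodule (⊤ : Submodule (ZMod 2) (Label E)) x
  have h1 : ∑ g : (⊤ : Submodule (ZMod 2) (Label E)), sgn (x ⬝ᵥ (g : Label E)) =
      ∑ w : Label E, sgn (w ⬝ᵥ x) := by
    rw [← Equiv.sum_comp (Submodule.topEquiv (R := ZMod 2) (M := Label E)).toEquiv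
      fun w => sgn (w ⬝ᵥ x)]
    exact Finset.sum_congr rfl fun g _ => by rw [dotProduct_comm]; rfl
  have h2 : x ∈ dotPerp (⊤ : Submodule (ZMod 2) (Label E)) ↔ x = 0 := by
    constructor
    · intro hx
      funext i
      have := hx (Pi.single i 1) trivial
      simpa using this
    · rintro rfl
      exact zero_mem _
  have h3 : Fintype.card (⊤ : Submodule (ZMod 2) (Label E)) = Fintype.card (Label E) :=
    Fintype.card_congr (Submodule.topEquiv (R := ZMod 2) (M := Label E)).toEquiv
  rw [← h1, h, h3]
  simp only [h2]

-- Double counting of the character sum over all pairs `(w, g)`: summing over `g` first leaves the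
-- `w` orthogonal to `S`, summing over `w` first leaves only `g = 0`.
open scoped Classical in
theorem card_mul_card_dotPerp (S : Submodule (ZMod 2) (Label E)) :
    (Fintype.card S : ℂ) * Fintype.card (dotPerp S) = Fintype.card (Label E) := by
  have h : ∑ w : Label E, ∑ g : S, sgn (w ⬝ᵥ (g : Label E)) =
      ∑ g : S, ∑ w : Label E, sgn (w ⬝ᵥ (g : Label E)) := Finset.sum_comm
  simp only [sum_sgn, sum_sgn_submodule] at h
  rw [Finset.sum_ite, Finset.sum_ite] at h
  simp only [Finset.sum_const, nsmul_eq_mul, mul_zero, add_zero] at h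
  have h1 : (Finset.univ.filter fun g : S => (g : Label E) = 0) = {0} := by
    ext g; simp
  rw [h1, ← Fintype.card_subtype] at h
  simp only [Finset.card_singleton, Nat.cast_one, one_mul] at h
  rw [← h, mul_comm]

open scoped Classical in
/-- The Kraus operator that undoes `X_a Z_b` and projects to the states supported on `K` and
invariant under `B`, up to the scalar `c`. -/
def recovery (K B : Submodule (ZMod 2) (Label E)) (c : ℂ) (a b : Label E) :
    Matrix (Label E) (Label E) ℂ :=
  Matrix.of fun y x => if y ∈ K ∧ x - y - a ∈ B then c * sgn (b ⬝ᵥ x) else 0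

open scoped Classical in
theorem recovery_mulVec (K B : Submodule (ZMod 2) (Label E)) (c : ℂ) (a b : Label E)
    (φ : Label E → ℂ) (y : Label E) :
    (recovery K B c a b).mulVec φ y =
      if y ∈ K then c * ∑ g : B, sgn (b ⬝ᵥ (y + a + g)) * φ (y + a + g) else 0 := by
  simp only [Matrix.mulVec, dotProduct, recovery, Matrix.of_apply]
  split_ifs with hy
  · simp only [hy, true_and]
    rw [← Equiv.sum_comp (Equiv.addLeft (y + a))]
    have h : ∀ g : Label E, y + a + g - y - a = g := fun g => by abel
    simp only [Equiv.coe_addLeft, h, ite_mul, zero_mul, Finset.mul_sum]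
    rw [← Finset.sum_filter, Finset.sum_subtype (p := fun g => g ∈ B) _ (by simp)]
    exact Finset.sum_congr rfl fun g _ => by ring
  · simp [hy]

-- The operators are indexed by all pairs of labels rather than by pairs of cosets. Each operator is
-- thus repeated, and `c` absorbs the multiplicity. The sum over phases kills the off-diagonal
-- entries, and on the diagonal the three counts in `hc` remain.
open scoped Classical in
theorem sum_recovery (K B : Submodule (ZMod 2) (Label E)) (hBK : B ≤ K) (c : ℂ)
    (hc : star c * c * (Fintype.card (Label E) * (Fintype.card B * Fintype.card K)) = 1)
    (r s : Label E → Label E) (hr : ∀ v, r v - v ∈ K) (hs : ∀ v, s v - v ∈ dotPerp B) :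
    ∑ p : Label E × Label E,
      (recovery K B c (r p.1) (s p.2)).conjTranspose * recovery K B c (r p.1) (s p.2) = 1 := by
  ext x x'
  rw [Matrix.sum_apply, Fintype.sum_prod_type]
  simp only [Matrix.mul_apply, Matrix.conjTranspose_apply, recovery, Matrix.of_apply]
  have key : ∀ α : Label E, ∑ β : Label E, ∑ y : Label E,
      star (if y ∈ K ∧ x - y - r α ∈ B then c * sgn (s β ⬝ᵥ x) else 0) *
        (if y ∈ K ∧ x' - y - r α ∈ B then c * sgn (s β ⬝ᵥ x') else 0) =
      if x = x' then star c * c * Fintype.card (Label E) *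
        (if x - α ∈ K then (Fintype.card B : ℂ) else 0) else 0 := by
    intro α
    rw [Finset.sum_comm]
    have h1 : ∀ y : Label E, ∑ β : Label E,
        star (if y ∈ K ∧ x - y - r α ∈ B then c * sgn (s β ⬝ᵥ x) else 0) *
        (if y ∈ K ∧ x' - y - r α ∈ B then c * sgn (s β ⬝ᵥ x') else 0) =
        if y ∈ K ∧ x - y - r α ∈ B then
          (if x = x' then star c * c * Fintype.card (Label E) else 0) else 0 := by
      intro y
      by_cases hx : y ∈ K ∧ x - y - r α ∈ B
      · rw [if_pos hx]
        by_cases hx' : y ∈ K ∧ x' - y - r α ∈ B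
        -- Both entries nonzero forces `x - x'` into `B`, where `s β` and `β` define the same
        -- character. The sum then runs over all characters.
        · have hd : x - x' ∈ B := by
            have := sub_mem hx.2 hx'.2
            convert this using 1
            abel
          have h2 : ∀ β : Label E, star (c * sgn (s β ⬝ᵥ x)) * (c * sgn (s β ⬝ᵥ x')) =
              star c * c * sgn (β ⬝ᵥ (x - x')) := by
            intro β
            have h3 : s β ⬝ᵥ (x - x') = β ⬝ᵥ (x - x') := by
              have := hs β _ hd
              rwa [sub_dotProduct, sub_eq_zero] at this
            rw [← h3, dotProduct_sub, sgn_sub, star_mul, star_sgn]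
            ring
          simp only [if_pos hx, if_pos hx', h2]
          rw [← Finset.mul_sum, sum_sgn]
          simp [sub_eq_zero]
        · have hne : x ≠ x' := by
            rintro rfl
            exact hx' hx
          simp [hx', hne]
      · simp [hx]
    rw [Finset.sum_congr rfl fun y _ => h1 y]
    split_ifs with h2 h3
    · rw [← Finset.sum_filter, Finset.sum_const, nsmul_eq_mul, mul_comm]
      congr 2
      rw [← Fintype.card_subtype]
      -- The map `y ↦ x - y - r α` is a bijection from the contributing `y` to `B`.
      refine Fintype.card_congr ⟨fun y => ⟨_, y.2.2⟩,
        fun g => ⟨x - r α - g, ?_, ?_⟩, fun y => ?_, fun g => ?_⟩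
      · have := sub_mem (sub_mem h3 (hr α)) (hBK g.2)
        convert this using 1
        abel
      · convert g.2 using 1
        abel
      · ext1; simp only; abel
      · ext1; simp only; abel
    · rw [mul_zero]
      refine Finset.sum_eq_zero fun y _ => if_neg ?_
      rintro ⟨hy, hy'⟩
      refine h3 ?_
      have := add_mem (add_mem hy (hBK hy')) (hr α)
      convert this using 1
      abel
    · simp
  rw [Finset.sum_congr rfl fun α _ => key α]
  by_cases hx : x = x'
  · subst hx
    simp only [if_true, Matrix.one_apply_eq]
    rw [← Finset.mul_sum, ← Finset.sum_filter, Finset.sum_const, nsmul_eq_mul]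
    have h : (Finset.univ.filter fun α => x - α ∈ K).card = Fintype.card K := by
      rw [← Fintype.card_subtype]
      exact Fintype.card_congr ⟨fun y => ⟨_, y.2⟩, fun g => ⟨x - g, by simp⟩,
        fun y => by simp, fun g => by simp⟩
    rw [h, ← hc]
    ring
  · simp [hx]

-- A guess `(α, β)` with the wrong syndrome gives zero: either the shifted state misses `K`, or the
-- character sum over `B` vanishes. With the right syndrome, `hX` and `hZ` make the residual error
-- act as a phase.
open scoped Classical in
theorem recovery_mulVec_error (K B : Submodule (ZMod 2) (Label E)) (c : ℂ)
    (a b α β : Label E) (ψ : Label E → ℂ)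
    (hψK : ∀ x, x ∉ K → ψ x = 0) (hψB : ∀ x, ∀ g ∈ B, ψ (x + g) = ψ x)
    (hX : α - a ∈ K → α - a ∈ B)
    (hZ : β - b ∈ dotPerp B → β - b ∈ dotPerp K) :
    ∃ θ : ℂ, θ * star θ = 1 ∧
      (recovery K B c α β).mulVec ((opX a * opZ b).mulVec ψ) =
      (if α - a ∈ K ∧ β - b ∈ dotPerp B then θ * (c * Fintype.card B) else 0) • ψ := by
  -- The signs left after evaluating the characters at `y + α + g` and `y + α + g - a`. The part
  -- depending on `y` disappears because `β - b` is then orthogonal to `K`.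
  refine ⟨sgn ((β - b) ⬝ᵥ α) * sgn (b ⬝ᵥ a), ?_, ?_⟩
  · rw [star_mul, star_sgn, star_sgn]
    linear_combination sgn (b ⬝ᵥ a) * sgn (b ⬝ᵥ a) * sgn_mul_self ((β - b) ⬝ᵥ α) +
      sgn_mul_self (b ⬝ᵥ a)
  funext y
  rw [recovery_mulVec, Pi.smul_apply, smul_eq_mul]
  by_cases hy : y ∈ K
  swap
  · rw [if_neg hy, hψK y hy, mul_zero]
  rw [if_pos hy]
  simp only [← Matrix.mulVec_mulVec, opX_mulVec, opZ_mulVec]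
  have hsgn : ∀ g : B, sgn (β ⬝ᵥ (y + α + g)) * (sgn (b ⬝ᵥ (y + α + g - a)) *
      ψ (y + α + g - a)) = sgn ((β - b) ⬝ᵥ (y + α)) * sgn (b ⬝ᵥ a) *
        (sgn ((β - b) ⬝ᵥ (g : Label E)) * ψ (y + (α - a))) := by
    intro g
    have h1 : ψ (y + α + g - a) = ψ (y + (α - a)) := by
      rw [← hψB (y + (α - a)) g g.2]
      congr 1
      abel
    have h2 : β ⬝ᵥ (y + α + g) = (β - b) ⬝ᵥ (y + α) + (β - b) ⬝ᵥ (g : Label E) +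
        b ⬝ᵥ (y + α + g) := by
      simp only [sub_dotProduct, dotProduct_add]
      ring
    rw [h1, h2, dotProduct_sub, sgn_sub, sgn_add, sgn_add]
    linear_combination sgn ((β - b) ⬝ᵥ (y + α)) * sgn (b ⬝ᵥ a) *
        (sgn ((β - b) ⬝ᵥ (g : Label E)) * ψ (y + (α - a))) * sgn_mul_self (b ⬝ᵥ (y + α + g))
  rw [Finset.sum_congr rfl fun g _ => hsgn g, ← Finset.mul_sum, ← Finset.sum_mul,
    sum_sgn_submodule]
  by_cases h1 : α - a ∈ K
  swap
  · rw [hψK (y + (α - a)) fun h => h1 (by simpa using sub_mem h hy),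
      if_neg (show ¬(α - a ∈ K ∧ β - b ∈ dotPerp B) from fun h => h1 h.1)]
    simp
  by_cases h2 : β - b ∈ dotPerp B
  swap
  · rw [if_neg h2, if_neg fun h => h2 h.2]
    simp
  rw [if_pos h2, if_pos ⟨h1, h2⟩, hψB y _ (hX h1), dotProduct_add, hZ h2 y hy, zero_add]
  ring

open scoped Classical in
theorem corrects_of_distances (K B : Submodule (ZMod 2) (Label E)) (hBK : B ≤ K)
    {dx dz : ℕ} (hdx : 0 < dx) (hdz : 0 < dz)
    (hX : ∀ u ∈ K, hammingNorm u < dx → u ∈ B)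
    (hZ : ∀ w ∈ dotPerp B, hammingNorm w < dz → w ∈ dotPerp K)
    (Q : Submodule ℂ (Label E → ℂ)) (hQK : ∀ ψ ∈ Q, ∀ x, x ∉ K → ψ x = 0)
    (hQB : ∀ ψ ∈ Q, ∀ x, ∀ g ∈ B, ψ (x + g) = ψ x) :
    Corrects Q {A | ∃ a b : Label E, hammingNorm a ≤ (dx - 1) / 2 ∧
      hammingNorm b ≤ (dz - 1) / 2 ∧ A = opX a * opZ b} := by
  obtain ⟨r, hr⟩ := exists_min_weight_representative K
  obtain ⟨s, hs⟩ := exists_min_weight_representative (dotPerp B)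
  set N : ℝ := Fintype.card (Label E) * (Fintype.card B * Fintype.card K) with hN
  have hNpos : 0 < N := by
    have h1 : 0 < Fintype.card B := Fintype.card_pos
    have h2 : 0 < Fintype.card K := Fintype.card_pos
    have h3 : 0 < Fintype.card (Label E) := Fintype.card_pos
    positivity
  obtain ⟨c, hc⟩ : ∃ c : ℂ, c = ((Real.sqrt N)⁻¹ : ℝ) := ⟨_, rfl⟩
  have hcc : star c * c * (Fintype.card (Label E) * (Fintype.card B * Fintype.card K)) = 1 := by
    have h1 : ((Real.sqrt N)⁻¹ * (Real.sqrt N)⁻¹) * N = 1 := by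
      rw [← mul_inv, Real.mul_self_sqrt hNpos.le, inv_mul_cancel₀ hNpos.ne']
    have h2 : star c = c := by rw [hc]; exact Complex.conj_ofReal _
    rw [h2, hc]
    have h3 := congrArg (fun t : ℝ => (t : ℂ)) h1
    simp only [hN] at h3 ⊢
    push_cast at h3 ⊢
    exact h3
  let e := Fintype.equivFin (Label E × Label E)
  let R : Label E × Label E → Matrix (Label E) (Label E) ℂ :=
    fun p => recovery K B c (r p.1) (s p.2)
  refine ⟨Fintype.card (Label E × Label E), fun j => R (e.symm j), ?_, ?_⟩
  · rw [Equiv.sum_comp e.symm fun p => (R p).conjTranspose * R p]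
    exact sum_recovery K B hBK c hcc r s (fun v => (hr v).1) fun v => (hs v).1
  rintro _ ⟨a, b, ha, hb, rfl⟩ ψ hψ
  rw [Equiv.sum_comp e.symm fun p => Matrix.vecMulVec
    ((R p).mulVec ((opX a * opZ b).mulVec ψ)) (star ((R p).mulVec ((opX a * opZ b).mulVec ψ)))]
  have key : ∀ p : Label E × Label E, Matrix.vecMulVec
      ((R p).mulVec ((opX a * opZ b).mulVec ψ))
      (star ((R p).mulVec ((opX a * opZ b).mulVec ψ))) =
      (if p.1 - a ∈ K ∧ p.2 - b ∈ dotPerp B then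
        star c * c * (Fintype.card B * Fintype.card B) else 0) • Matrix.vecMulVec ψ (star ψ) := by
    rintro ⟨α, β⟩
    have e1 : r α - a ∈ K ↔ α - a ∈ K := by
      rw [← sub_add_sub_cancel (r α) α a]
      exact Submodule.add_mem_iff_right _ (hr α).1
    have e2 : s β - b ∈ dotPerp B ↔ β - b ∈ dotPerp B := by
      rw [← sub_add_sub_cancel (s β) β b]
      exact Submodule.add_mem_iff_right _ (hs β).1
    -- When the syndromes agree, the leader is no heavier than the actual error, so their difference
    -- has weight below the distance.
    obtain ⟨θ, hθ, h⟩ := recovery_mulVec_error K B c a b (r α) (s β) ψ (hQK ψ hψ) (hQB ψ hψ)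
      (fun h => hX _ h <| hammingNorm_sub_lt hdx (((hr α).2 a (e1.1 h)).trans ha) ha)
      (fun h => hZ _ h <| hammingNorm_sub_lt hdz (((hs β).2 b (e2.1 h)).trans hb) hb)
    simp only [R, h, e1, e2]
    split_ifs
    · rw [star_smul, Matrix.smul_vecMulVec, Matrix.vecMulVec_smul, smul_smul]
      congr 1
      simp only [star_mul, star_natCast]
      linear_combination star c * c * (Fintype.card B * Fintype.card B) * hθ
    · simp
  rw [Finset.sum_congr rfl fun p _ => key p, ← Finset.sum_smul, Fintype.sum_prod_type]
  have hcount : ∀ (S : Submodule (ZMod 2) (Label E)) (u : Label E),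
      (Finset.univ.filter fun v => v - u ∈ S).card = Fintype.card S := by
    intro S u
    rw [← Fintype.card_subtype]
    exact Fintype.card_congr ⟨fun y => ⟨_, y.2⟩, fun g => ⟨g + u, by simp⟩,
      fun y => by simp, fun g => by simp⟩
  -- There are `|K| |B^⊥|` surviving pairs, each of weight `|c|² |B|²`. Since `|B| |B^⊥|` is the
  -- number of labels, the total is the normalisation of `c`.
  have hsum : ∑ α : Label E, ∑ β : Label E, (if α - a ∈ K ∧ β - b ∈ dotPerp B then
      star c * c * (Fintype.card B * Fintype.card B) else 0) = 1 := by
    have h1 : ∀ α : Label E, ∑ β : Label E, (if α - a ∈ K ∧ β - b ∈ dotPerp B then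
      star c * c * (Fintype.card B * Fintype.card B) else 0) = if α - a ∈ K then
        Fintype.card (dotPerp B) * (star c * c * (Fintype.card B * Fintype.card B)) else 0 := by
      intro α
      split_ifs with h
      · simp only [h, true_and]
        rw [← Finset.sum_filter, Finset.sum_const, nsmul_eq_mul, hcount]
      · simp [h]
    rw [Finset.sum_congr rfl fun α _ => h1 α, ← Finset.sum_filter, Finset.sum_const, nsmul_eq_mul,
      hcount, ← hcc, ← card_mul_card_dotPerp B]
    ring
  rw [hsum, one_smul]

theorem mem_topologicalCode_iff {V F : Type} [Fintype F] (bd₁ : Matrix V E (ZMod 2))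
    (bd₂ : Matrix E F (ZMod 2)) (ψ : Label E → ℂ) :
    ψ ∈ topologicalCode bd₁ bd₂ ↔ (∀ x, x ∉ bd₁.mulVecLin.ker → ψ x = 0) ∧
      ∀ x, ∀ g ∈ bd₂.mulVecLin.range, ψ (x + g) = ψ x := by
  classical
  have h0 : ψ ∈ topologicalCode bd₁ bd₂ ↔ (∀ f : F, (opX fun e => bd₂ e f).mulVec ψ = ψ) ∧
    ∀ v : V, (opZ fun e => bd₁ v e).mulVec ψ = ψ := Iff.rfl
  rw [h0]
  constructor
  · rintro ⟨hX, hZ⟩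
    constructor
    · intro x hx
      rw [LinearMap.mem_ker, Matrix.mulVecLin_apply] at hx
      obtain ⟨v, hv⟩ := Function.ne_iff.1 hx
      have h1 := congrFun (hZ v) x
      have h2 : (fun e => bd₁ v e) ⬝ᵥ x = 1 := (zmod_two_eq_zero_or_one _).resolve_left hv
      rw [opZ_mulVec, h2, sgn_one, neg_one_mul] at h1
      exact self_eq_neg.mp h1.symm
    · intro x g hg
      rw [Matrix.range_mulVecLin] at hg
      induction hg using Submodule.span_induction generalizing x with
      | mem g hg =>
        obtain ⟨f, rfl⟩ := hg
        have h1 := congrFun (hX f) (x + bd₂.col f)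
        rw [opX_mulVec] at h1
        rw [← h1]
        congr 1
        funext e
        simp [Matrix.col]
      | zero => simp
      | add g h _ _ ihg ihh => rw [← add_assoc, ihh, ihg]
      | smul z g _ ih =>
        rcases zmod_two_eq_zero_or_one z with rfl | rfl
        · simp
        · rw [one_smul, ih]
  · rintro ⟨hK, hB⟩
    constructor
    · intro f
      funext y
      rw [opX_mulVec, ← hB (y - fun e => bd₂ e f) (fun e => bd₂ e f), sub_add_cancel]
      refine ⟨Pi.single f 1, ?_⟩
      rw [Matrix.mulVecLin_apply, Matrix.mulVec_single_one]
      rfl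
    · intro v
      funext y
      rw [opZ_mulVec]
      by_cases hy : y ∈ bd₁.mulVecLin.ker
      · rw [LinearMap.mem_ker, Matrix.mulVecLin_apply] at hy
        have : (fun e => bd₁ v e) ⬝ᵥ y = 0 := congrFun hy v
        rw [this, sgn_zero, one_mul]
      · rw [hK y hy, mul_zero]

theorem isAsymmetricCode_topologicalCode {V F : Type} [Fintype V] [Fintype F]
    (bd₁ : Matrix V E (ZMod 2)) (bd₂ : Matrix E F (ZMod 2)) (hbd : bd₁ * bd₂ = 0)
    {H : Type*} [AddGroup H] [Fintype H] (φ : Label E →+ H)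
    (hker : ∀ x, bd₁.mulVec x = 0 → (φ x = 0 ↔ ∃ s, bd₂.mulVec s = x))
    (hsurj : ∀ t, ∃ x, bd₁.mulVec x = 0 ∧ φ x = t)
    {n k dz dx : ℕ} (hn : Fintype.card E = n) (hk : Fintype.card H = 2 ^ k)
    (hdz : 0 < dz) (hdx : 0 < dx)
    (hz : dz ∈ lowerBounds (nontrivialCycleLengths bd₂.transpose bd₁.transpose))
    (hx : dx ∈ lowerBounds (nontrivialCycleLengths bd₁ bd₂)) :
    IsAsymmetricCode (topologicalCode bd₁ bd₂) n k dz dx := by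
  have hBK : bd₂.mulVecLin.range ≤ bd₁.mulVecLin.ker := by
    rintro _ ⟨s, rfl⟩
    simp [LinearMap.mem_ker, hbd]
  refine ⟨hn, ?_, corrects_of_distances bd₁.mulVecLin.ker bd₂.mulVecLin.range hBK hdx hdz ?_ ?_ _
    (fun ψ hψ => ((mem_topologicalCode_iff bd₁ bd₂ ψ).1 hψ).1)
    (fun ψ hψ => ((mem_topologicalCode_iff bd₁ bd₂ ψ).1 hψ).2)⟩
  · rw [← hk]
    exact finrank_of_classes _ _ hBK φ (fun x hx => hker x hx) hsurj _
      (mem_topologicalCode_iff bd₁ bd₂)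
  · intro u hu hlt
    by_contra hB
    exact absurd (hx ⟨u, ⟨hu, hB⟩, rfl⟩) (by omega)
  · intro w hw hlt
    -- Orthogonality to the image of `∂₂` is the cycle condition of the dual tessellation, and a
    -- dual boundary is orthogonal to `K`.
    have hw' : bd₂.transpose.mulVec w = 0 := by
      classical
      funext f
      have h1 := hw (bd₂.mulVec (Pi.single f 1)) ⟨_, rfl⟩
      rw [Matrix.dotProduct_mulVec, dotProduct_single_one] at h1
      rw [Matrix.mulVec_transpose]
      exact h1
    have h1 : ∃ s, bd₁.transpose.mulVec s = w := by
      by_contra hB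
      exact absurd (hz ⟨w, ⟨hw', hB⟩, rfl⟩) (by omega)
    obtain ⟨s, rfl⟩ := h1
    intro x hx
    rw [Matrix.mulVec_transpose, ← Matrix.dotProduct_mulVec]
    have : bd₁.mulVec x = 0 := hx
    rw [this, dotProduct_zero]

end Register

/-! ### The combinatorial hexagonal torus -/

/-! ### Discrete integration on the cyclic group and on the square torus -/

section Cyclic

variable {ξ : ℕ} [NeZero ξ]

theorem zmod_induction {P : ZMod ξ → Prop} (h0 : P 0) (h1 : ∀ i, P i → P (i + 1)) (i : ZMod ξ) :
    P i := by
  have h : ∀ n : ℕ, P (n : ZMod ξ) := by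
    intro n
    induction n with
    | zero => simpa using h0
    | succ n ih => simpa using h1 _ ih
  simpa using h i.val

/-- Partial sums form a primitive; the vanishing total is what closes it up at the wrap from `ξ - 1`
to `0`. -/
theorem exists_primitive {A : Type*} [AddCommGroup A] (f : ZMod ξ → A) (hf : ∑ i, f i = 0) :
    ∃ s : ZMod ξ → A, s 0 = 0 ∧ ∀ i, f i = s (i + 1) - s i := by
  refine ⟨fun i => ∑ k ∈ Finset.range i.val, f k, by simp, fun i => ?_⟩
  have h1 : f i = f (i.val : ℕ) := by simp
  beta_reduce
  rcases Nat.lt_or_ge (i.val + 1) ξ with h | h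
  · have h2 : (i + 1).val = i.val + 1 := by
      have : i + 1 = ((i.val + 1 : ℕ) : ZMod ξ) := by simp
      rw [this, ZMod.val_natCast_of_lt h]
    rw [h2, Finset.sum_range_succ, add_sub_cancel_left]
    exact h1
  · have h2 : i.val + 1 = ξ := le_antisymm (ZMod.val_lt i) h
    have h3 : i + 1 = 0 := by
      have : i + 1 = ((i.val + 1 : ℕ) : ZMod ξ) := by simp
      rw [this, h2, ZMod.natCast_self]
    have h4 : ∑ k ∈ Finset.range ξ, f k = 0 := by
      rw [← hf]
      refine Finset.sum_bij' (fun k _ => (k : ZMod ξ)) (fun i _ => i.val) ?_ ?_ ?_ ?_ ?_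
      · simp
      · intro i _; simpa using ZMod.val_lt i
      · intro k hk; exact ZMod.val_natCast_of_lt (by simpa using hk)
      · simp
      · simp
    rw [show Finset.range ξ = Finset.range (i.val + 1) by rw [h2], Finset.sum_range_succ] at h4
    rw [h3, ZMod.val_zero, Finset.sum_range_zero, zero_sub, h1]
    exact eq_neg_of_add_eq_zero_right h4

theorem sum_add_one {A : Type*} [AddCommMonoid A] (f : ZMod ξ → A) :
    ∑ i, f (i + 1) = ∑ i, f i :=
  Equiv.sum_comp (Equiv.addRight (1 : ZMod ξ)) f

/-- A closed 1-cochain on the square grid of a torus with vanishing periods is exact. -/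
theorem exists_potential {A : Type*} [AddCommGroup A] (h v : ZMod ξ → ZMod ξ → A)
    (hclosed : ∀ i j, h i j + v (i + 1) j = v i j + h i (j + 1))
    (hh : ∑ i, h i 0 = 0) (hv : ∑ j, v 0 j = 0) :
    ∃ s : ZMod ξ → ZMod ξ → A, (∀ i j, h i j = s (i + 1) j - s i j) ∧
      ∀ i j, v i j = s i (j + 1) - s i j := by
  -- Summing closedness over a column shows that adjacent columns have equal periods.
  have hv' : ∀ i, ∑ j, v i j = 0 := by
    refine zmod_induction hv fun i hi => ?_
    have h1 : ∑ j, (h i j + v (i + 1) j) = ∑ j, (v i j + h i (j + 1)) :=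
      Finset.sum_congr rfl fun j _ => hclosed i j
    rw [Finset.sum_add_distrib, Finset.sum_add_distrib, hi, zero_add, sum_add_one fun j => h i j]
      at h1
    simpa using h1
  obtain ⟨r, -, hr⟩ := exists_primitive (fun i => h i 0) hh
  choose t ht0 ht using fun i => exists_primitive (fun j => v i j) (hv' i)
  -- Integrate along row `0`, then up column `i`. Closedness carries the horizontal identity from
  -- row `j` to row `j + 1`.
  refine ⟨fun i j => r i + t i j, fun i => ?_, fun i j => ?_⟩
  · refine zmod_induction ?_ fun j hj => ?_
    · simpa [ht0] using hr i
    · have h1 := hclosed i j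
      rw [hj, ht, ht] at h1
      beta_reduce at h1 ⊢
      rw [← add_right_inj (t i (j + 1) - t i j), ← h1]
      abel
  · rw [ht]
    beta_reduce
    abel

end Cyclic

/-- The cells of a `ξ × ξ` torus; cell `p` stands for the face with centre `p` in lattice
coordinates, and for the two triangles `p, p + e₁, p + e₂` and `p, p + e₂, p + e₂ - e₁` of the
dual tessellation. -/
abbrev Cell (ξ : ℕ) := ZMod ξ × ZMod ξ

/-- The edge `(p, k)` joins the vertex `p` of the first kind to the vertex `p + edgeOffset k` of the
second kind. -/
def edgeOffset {R : Type*} [Ring R] : Fin 3 → R × R := ![(0, 0), (1, 0), (1, -1)]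

/-- The edge `(p, k)` lies on the faces `p + faceOffset k` and `p + faceOffset' k`. -/
def faceOffset {R : Type*} [Ring R] : Fin 3 → R × R := ![(0, 0), (1, 0), (0, 0)]

/-- The second face on which the edge `(p, k)` lies, relative to `p`. -/
def faceOffset' {R : Type*} [Ring R] : Fin 3 → R × R := ![(0, 1), (0, 1), (1, 0)]

/-- The boundary matrix `∂₁` of the combinatorial hexagonal torus. -/
def gridBd₁ (ξ : ℕ) : Matrix (Cell ξ ⊕ Cell ξ) (Cell ξ × Fin 3) (ZMod 2) :=
  Matrix.of fun v e => Sum.elim (fun q => if e.1 = q then 1 else 0)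
    (fun q => if e.1 + edgeOffset e.2 = q then 1 else 0) v

/-- The boundary matrix `∂₂` of the combinatorial hexagonal torus. -/
def gridBd₂ (ξ : ℕ) : Matrix (Cell ξ × Fin 3) (Cell ξ) (ZMod 2) :=
  Matrix.of fun e f => (if e.1 + faceOffset e.2 = f then 1 else 0) +
    (if e.1 + faceOffset' e.2 = f then 1 else 0)

/-! ### Mod 2 homology of the combinatorial torus and the lengths of its cycles -/

section Grid

variable {ξ : ℕ} [NeZero ξ]

theorem gridBd₂_mulVec (s : Cell ξ → ZMod 2) (e : Cell ξ × Fin 3) :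
    (gridBd₂ ξ).mulVec s e = s (e.1 + faceOffset e.2) + s (e.1 + faceOffset' e.2) := by
  simp [Matrix.mulVec, dotProduct, gridBd₂, add_mul, Finset.sum_add_distrib]

theorem gridBd₁_mulVec_inl (z : Cell ξ × Fin 3 → ZMod 2) (q : Cell ξ) :
    (gridBd₁ ξ).mulVec z (Sum.inl q) = z (q, 0) + z (q, 1) + z (q, 2) := by
  simp [Matrix.mulVec, dotProduct, gridBd₁, Fintype.sum_prod_type_right, Fin.sum_univ_three]

theorem gridBd₁_mulVec_inr (z : Cell ξ × Fin 3 → ZMod 2) (i j : ZMod ξ) :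
    (gridBd₁ ξ).mulVec z (Sum.inr (i, j)) =
      z ((i, j), 0) + z ((i - 1, j), 1) + z ((i - 1, j + 1), 2) := by
  have h : ∀ (p : Cell ξ) (k : Fin 3), p + edgeOffset k = (i, j) ↔ p = (i, j) - edgeOffset k :=
    fun p k => eq_sub_iff_add_eq.symm
  simp only [Matrix.mulVec, dotProduct, gridBd₁, Matrix.of_apply, Sum.elim_inr, h,
    Fintype.sum_prod_type_right, Fin.sum_univ_three]
  rw [← Fintype.sum_prod_type_right', ← Fintype.sum_prod_type_right',
    ← Fintype.sum_prod_type_right']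
  simp [edgeOffset]

theorem gridBd₁_mul_gridBd₂ : gridBd₁ ξ * gridBd₂ ξ = 0 := by
  refine Matrix.ext_of_mulVec_single fun f => ?_
  rw [← Matrix.mulVec_mulVec, Matrix.zero_mulVec]
  generalize (Pi.single f 1 : Cell ξ → ZMod 2) = s
  funext v
  rcases v with ⟨i, j⟩ | ⟨i, j⟩
  · simp only [gridBd₁_mulVec_inl, gridBd₂_mulVec, faceOffset, faceOffset', Pi.zero_apply]
    simp
    grind
  · simp only [gridBd₁_mulVec_inr, gridBd₂_mulVec, faceOffset, faceOffset', Pi.zero_apply]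
    simp
    grind

/-- The cycle of the hexagonal torus that crosses the line of faces `(i, j)`, `i` varying, between
`i = k` and `i = k + 1`. -/
def fstCycle (k : ZMod ξ) : Cell ξ × Fin 3 → ZMod 2 :=
  fun e => if e.2 = 0 then 0 else if e.1.1 = k then 1 else 0

/-- The cycle of the hexagonal torus that crosses the line of faces `(i, j)`, `j` varying, between
`j = k` and `j = k + 1`. -/
def sndCycle (k : ZMod ξ) : Cell ξ × Fin 3 → ZMod 2 :=
  fun e => if e.2 = 2 then 0 else if e.1.2 = k then 1 else 0

theorem gridBd₁_fstCycle (k : ZMod ξ) : (gridBd₁ ξ).mulVec (fstCycle k) = 0 := by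
  funext v
  rcases v with ⟨i, j⟩ | ⟨i, j⟩
  · simp [gridBd₁_mulVec_inl, fstCycle, CharTwo.add_self_eq_zero]
  · simp [gridBd₁_mulVec_inr, fstCycle, CharTwo.add_self_eq_zero]

theorem gridBd₁_sndCycle (k : ZMod ξ) : (gridBd₁ ξ).mulVec (sndCycle k) = 0 := by
  funext v
  rcases v with ⟨i, j⟩ | ⟨i, j⟩
  · simp [gridBd₁_mulVec_inl, sndCycle, CharTwo.add_self_eq_zero]
  · simp [gridBd₁_mulVec_inr, sndCycle, CharTwo.add_self_eq_zero]

/-- The strip of faces between two neighbouring parallel cycles bounds their sum. -/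
theorem fstCycle_add_one (k : ZMod ξ) :
    ∃ s, fstCycle k + fstCycle (k + 1) = (gridBd₂ ξ).mulVec s := by
  refine ⟨fun p => if p.1 = k + 1 then 1 else 0, ?_⟩
  funext ⟨⟨i, j⟩, t⟩
  rw [gridBd₂_mulVec]
  fin_cases t <;>
    simp [fstCycle, faceOffset, faceOffset', CharTwo.add_self_eq_zero, add_comm]

theorem sndCycle_add_one (k : ZMod ξ) :
    ∃ s, sndCycle k + sndCycle (k + 1) = (gridBd₂ ξ).mulVec s := by
  refine ⟨fun p => if p.2 = k + 1 then 1 else 0, ?_⟩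
  funext ⟨⟨i, j⟩, t⟩
  rw [gridBd₂_mulVec]
  fin_cases t <;>
    simp [sndCycle, faceOffset, faceOffset', CharTwo.add_self_eq_zero, add_comm]

/-- The periods of a 1-chain: its intersection numbers with the two lines of faces through `0`. -/
def periods : Label (Cell ξ × Fin 3) →+ ZMod 2 × ZMod 2 where
  toFun z := (∑ i, z ((i, 0), 2), ∑ j, z ((0, j), 0))
  map_zero' := by simp
  map_add' := by intro x y; simp [Finset.sum_add_distrib]

theorem periods_smul (u : ZMod 2) (z : Label (Cell ξ × Fin 3)) :
    periods (u • z) = u • periods z := by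
  rcases zmod_two_eq_zero_or_one u with rfl | rfl <;> simp

theorem periods_fstCycle (k : ZMod ξ) : periods (fstCycle k) = (1, 0) := by
  simp [periods, fstCycle]

theorem periods_sndCycle (k : ZMod ξ) : periods (sndCycle k) = (0, 1) := by
  simp [periods, sndCycle]

theorem periods_gridBd₂ (s : Cell ξ → ZMod 2) : periods ((gridBd₂ ξ).mulVec s) = 0 := by
  simp only [periods, AddMonoidHom.coe_mk, ZeroHom.coe_mk, gridBd₂_mulVec]
  have h1 := sum_add_one fun i : ZMod ξ => s (i, 0)
  have h2 := sum_add_one fun j : ZMod ξ => s (0, j)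
  simp [faceOffset, faceOffset', Finset.sum_add_distrib, h1, h2, CharTwo.add_self_eq_zero]

/-- The two vertex relations say that `z` is closed on the two triangles of a dual square. Adding
them eliminates the diagonal edge and leaves closedness on the square grid. The potential is the
desired set of faces, and a triangle relation recovers the diagonal. -/
theorem exists_boundary_of_periods_eq_zero {z : Label (Cell ξ × Fin 3)}
    (hz : (gridBd₁ ξ).mulVec z = 0) (hp : periods z = 0) : ∃ s, (gridBd₂ ξ).mulVec s = z := by
  have hA : ∀ p, z (p, 0) + z (p, 1) + z (p, 2) = 0 := fun p => by
    rw [← gridBd₁_mulVec_inl, hz]; rfl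
  have hB : ∀ i j, z ((i, j), 0) + z ((i - 1, j), 1) + z ((i - 1, j + 1), 2) = 0 := fun i j => by
    rw [← gridBd₁_mulVec_inr, hz]; rfl
  obtain ⟨s, h2, h0⟩ := exists_potential (fun i j => z ((i, j), 2)) (fun i j => z ((i, j), 0))
    (by
      intro i j
      have h1 := hA (i, j)
      have h2 := hB (i + 1) j
      rw [add_sub_cancel_right] at h2
      grind)
    (congrArg Prod.fst hp) (congrArg Prod.snd hp)
  refine ⟨fun p => s p.1 p.2, ?_⟩
  funext ⟨⟨i, j⟩, t⟩
  rw [gridBd₂_mulVec]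
  have h1 := hA (i, j)
  have h2 := h2 i j
  have h0 := h0 i j
  fin_cases t <;> simp [faceOffset, faceOffset'] <;> grind

theorem exists_decomposition {z : Label (Cell ξ × Fin 3)} (hz : (gridBd₁ ξ).mulVec z = 0) :
    ∃ s, z = (gridBd₂ ξ).mulVec s + ((periods z).1 • fstCycle 0 + (periods z).2 • sndCycle 0) := by
  obtain ⟨s, hs⟩ := exists_boundary_of_periods_eq_zero
    (z := z - ((periods z).1 • fstCycle 0 + (periods z).2 • sndCycle 0))
    (by rw [Matrix.mulVec_sub, Matrix.mulVec_add, Matrix.mulVec_smul, Matrix.mulVec_smul,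
          gridBd₁_fstCycle, gridBd₁_sndCycle, hz]; simp)
    (by rw [map_sub, map_add, periods_smul, periods_smul, periods_fstCycle, periods_sndCycle]; simp)
  exact ⟨s, by rw [hs]; simp⟩

theorem exists_cycle_with_periods (t : ZMod 2 × ZMod 2) :
    ∃ z, (gridBd₁ ξ).mulVec z = 0 ∧ periods z = t := by
  refine ⟨t.1 • fstCycle 0 + t.2 • sndCycle 0, ?_, ?_⟩
  · rw [Matrix.mulVec_add, Matrix.mulVec_smul, Matrix.mulVec_smul,
      gridBd₁_fstCycle, gridBd₁_sndCycle]
    simp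
  · rw [map_add, periods_smul, periods_smul, periods_fstCycle, periods_sndCycle]
    simp

/-- The sums of a chain over the parallel lines of faces in the three directions. -/
def lineSum (z : Label (Cell ξ × Fin 3)) (k : Fin 3) (j : ZMod ξ) : ZMod 2 :=
  ∑ i, z (![(j, i), (i, j - i), (i, j)] k, k)

/-- Boundaries cancel along a closed line of faces, so only the homology class counts. A diagonal
line meets both basic cycles, hence the sum of the periods. -/
theorem lineSum_of_cycle {z : Label (Cell ξ × Fin 3)} (hz : (gridBd₁ ξ).mulVec z = 0) (k : Fin 3)
    (j : ZMod ξ) :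
    lineSum z k j = ![(periods z).2, (periods z).1 + (periods z).2, (periods z).1] k := by
  obtain ⟨s, hs⟩ := exists_decomposition hz
  set u := (periods z).1
  set w := (periods z).2
  rw [hs]
  fin_cases k
  · have h := sum_add_one fun i : ZMod ξ => s (j, i)
    simp [lineSum, gridBd₂_mulVec, fstCycle, sndCycle, faceOffset, faceOffset',
      Finset.sum_add_distrib, h, CharTwo.add_self_eq_zero]
  · have h := sum_add_one fun i : ZMod ξ => s (i, j - i + 1)
    have h' : ∀ i : ZMod ξ, j - (i + 1) + 1 = j - i := fun i => by ring
    simp only [h'] at h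
    simp [lineSum, gridBd₂_mulVec, fstCycle, sndCycle, faceOffset, faceOffset',
      Finset.sum_add_distrib, h, CharTwo.add_self_eq_zero, sub_eq_zero]
  · have h := sum_add_one fun i : ZMod ξ => s (i, j)
    simp [lineSum, gridBd₂_mulVec, fstCycle, sndCycle, faceOffset, faceOffset',
      Finset.sum_add_distrib, h, CharTwo.add_self_eq_zero]

theorem two_mul_le_of_nontrivial_cycle :
    2 * ξ ∈ lowerBounds (nontrivialCycleLengths (gridBd₁ ξ) (gridBd₂ ξ)) := by
  rintro _ ⟨z, ⟨hz, hnb⟩, rfl⟩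
  let ℓ : Cell ξ × Fin 3 → Fin 3 × ZMod ξ := fun e => (e.2, ![e.1.1, e.1.1 + e.1.2, e.1.2] e.2)
  let m : Fin 3 → ZMod 2 := ![(periods z).2, (periods z).1 + (periods z).2, (periods z).1]
  -- Among `w`, `u + w`, `u` with `(u, w) ≠ 0` mod 2, exactly two are nonzero.
  have hT : 2 ≤ (Finset.univ.filter fun k => m k ≠ 0).card := by
    have hp : periods z ≠ 0 := fun h => hnb (exists_boundary_of_periods_eq_zero hz h)
    revert hp
    simp only [m]
    generalize periods z = t
    revert t
    decide
  -- Each edge crosses just one line, recorded by `ℓ`, so lines with odd intersection contribute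
  -- distinct edges.
  have hsub : (Finset.univ.filter fun k => m k ≠ 0) ×ˢ (Finset.univ : Finset (ZMod ξ)) ⊆
      (Finset.univ.filter fun e => z e ≠ 0).image ℓ := by
    rintro ⟨k, j⟩ hk
    simp only [Finset.mem_product, Finset.mem_filter, Finset.mem_univ, true_and, and_true] at hk
    have h1 : lineSum z k j ≠ 0 := by rw [lineSum_of_cycle hz]; exact hk
    obtain ⟨i, -, hi⟩ := Finset.exists_ne_zero_of_sum_ne_zero h1
    refine Finset.mem_image.2 ⟨_, Finset.mem_filter.2 ⟨Finset.mem_univ _, hi⟩, ?_⟩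
    clear h1 hi hk
    fin_cases k <;> simp [ℓ]
  calc 2 * ξ ≤ (Finset.univ.filter fun k => m k ≠ 0).card * ξ := Nat.mul_le_mul_right _ hT
    _ = ((Finset.univ.filter fun k => m k ≠ 0) ×ˢ (Finset.univ : Finset (ZMod ξ))).card := by
        rw [Finset.card_product, Finset.card_univ, ZMod.card]
    _ ≤ _ := Finset.card_le_card hsub
    _ ≤ (Finset.univ.filter fun e => z e ≠ 0).card := Finset.card_image_le

end Grid

/-- The range of the transpose is the annihilator of the kernel; thus a nontrivial dual cycle is
detected by an ordinary cycle. -/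
theorem exists_kernel_dotProduct_ne_zero {K V E : Type*} [Field K] [Fintype V] [Fintype E]
    (M : Matrix V E K) (c : E → K) (hc : ¬ ∃ s, M.transpose.mulVec s = c) :
    ∃ z, M.mulVec z = 0 ∧ c ⬝ᵥ z ≠ 0 := by
  classical
  by_contra hcon
  push Not at hcon
  have h1 : (dotProductEquiv K E c) ∈ M.mulVecLin.ker.dualAnnihilator := by
    rw [Submodule.mem_dualAnnihilator]
    intro z hz
    exact hcon z hz
  rw [← LinearMap.range_dualMap_eq_dualAnnihilator_ker] at h1
  obtain ⟨g, hg⟩ := h1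
  obtain ⟨s, rfl⟩ := (dotProductEquiv K V).surjective g
  refine hc ⟨s, ?_⟩
  rw [Matrix.mulVec_transpose]
  refine (dotProductEquiv K E).injective (LinearMap.ext fun z => ?_)
  rw [← hg]
  simp [Matrix.dotProduct_mulVec]

/-! ### Intersection pairing and the shortest nontrivial dual cycle -/

section Grid

variable {ξ : ℕ} [NeZero ξ]

theorem dotProduct_boundary {c : Label (Cell ξ × Fin 3)}
    (hc : (gridBd₂ ξ).transpose.mulVec c = 0) (s : Cell ξ → ZMod 2) :
    c ⬝ᵥ (gridBd₂ ξ).mulVec s = 0 := by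
  rw [Matrix.dotProduct_mulVec, ← Matrix.mulVec_transpose, hc, zero_dotProduct]

theorem dotProduct_eq_of_homologous {c : Label (Cell ξ × Fin 3)}
    (hc : (gridBd₂ ξ).transpose.mulVec c = 0) (C : ZMod ξ → Label (Cell ξ × Fin 3))
    (hC : ∀ k, ∃ s, C k + C (k + 1) = (gridBd₂ ξ).mulVec s) (k : ZMod ξ) :
    c ⬝ᵥ C k = c ⬝ᵥ C 0 := by
  refine zmod_induction (P := fun k => c ⬝ᵥ C k = c ⬝ᵥ C 0) rfl (fun k hk => ?_) k
  obtain ⟨s, hs⟩ := hC k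
  have h := dotProduct_boundary hc s
  rw [← hs, dotProduct_add, hk] at h
  grind

theorem le_hammingNorm_of_disjoint (c : Label (Cell ξ × Fin 3))
    (C : ZMod ξ → Label (Cell ξ × Fin 3)) (hC : ∀ k, c ⬝ᵥ C k ≠ 0)
    (ℓ : Cell ξ × Fin 3 → ZMod ξ) (hℓ : ∀ k e, C k e ≠ 0 → ℓ e = k) : ξ ≤ hammingNorm c := by
  have hsub : (Finset.univ : Finset (ZMod ξ)) ⊆ (Finset.univ.filter fun e => c e ≠ 0).image ℓ := by
    intro k _
    obtain ⟨e, -, he⟩ := Finset.exists_ne_zero_of_sum_ne_zero (hC k)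
    exact Finset.mem_image.2 ⟨e, by simpa using left_ne_zero_of_mul he,
      hℓ k e (right_ne_zero_of_mul he)⟩
  calc ξ = (Finset.univ : Finset (ZMod ξ)).card := by rw [Finset.card_univ, ZMod.card]
    _ ≤ _ := Finset.card_le_card hsub
    _ ≤ (Finset.univ.filter fun e => c e ≠ 0).card := Finset.card_image_le

/-- A cycle detecting `c` is homologous to a combination of the two basic cycles, so `c` pairs
nontrivially with one of them, hence with all its `ξ` pairwise disjoint parallel copies. -/
theorem le_of_nontrivial_dual_cycle :
    ξ ∈ lowerBounds (nontrivialCycleLengths (gridBd₂ ξ).transpose (gridBd₁ ξ).transpose) := by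
  rintro _ ⟨c, ⟨hc, hnb⟩, rfl⟩
  obtain ⟨z, hz, hcz⟩ := exists_kernel_dotProduct_ne_zero _ c hnb
  obtain ⟨s, hs⟩ := exists_decomposition hz
  rw [hs, dotProduct_add, dotProduct_boundary hc, zero_add, dotProduct_add, dotProduct_smul,
    dotProduct_smul] at hcz
  by_cases h : c ⬝ᵥ fstCycle 0 = 0
  · have h' : c ⬝ᵥ sndCycle 0 ≠ 0 := by
      intro h'
      simp [h, h'] at hcz
    refine le_hammingNorm_of_disjoint c sndCycle (fun k => ?_) (fun e => e.1.2) ?_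
    · rwa [dotProduct_eq_of_homologous hc _ sndCycle_add_one]
    · intro k e he
      by_contra hne
      simp [sndCycle, hne] at he
  · refine le_hammingNorm_of_disjoint c fstCycle (fun k => ?_) (fun e => e.1.1) ?_
    · rwa [dotProduct_eq_of_homologous hc _ fstCycle_add_one]
    · intro k e he
      by_contra hne
      simp [fstCycle, hne] at he

/-- The straight cycle of the dual tessellation through the faces `(i, 0)`. -/
def dualLine : Label (Cell ξ × Fin 3) := fun e => if e.2 = 2 ∧ e.1.2 = 0 then 1 else 0

theorem dualLine_dotProduct (z : Label (Cell ξ × Fin 3)) :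
    dualLine ⬝ᵥ z = (periods z).1 := by
  simp only [dotProduct, dualLine, periods, AddMonoidHom.coe_mk, ZeroHom.coe_mk,
    Fintype.sum_prod_type_right, Fin.sum_univ_three]
  rw [Finset.sum_eq_single 0 (by intro j _ hj; simp [hj]) (by simp)]
  simp

theorem isLeast_dual_cycle_lengths :
    IsLeast (nontrivialCycleLengths (gridBd₂ ξ).transpose (gridBd₁ ξ).transpose) ξ := by
  -- Pairing with the line computes the first period, which vanishes on boundaries but not on
  -- `fstCycle 0`.
  have hmem : dualLine ∈ nontrivialCycles (gridBd₂ ξ).transpose (gridBd₁ ξ).transpose := by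
    constructor
    · funext f
      have h := dualLine_dotProduct ((gridBd₂ ξ).mulVec (Pi.single f 1))
      rw [periods_gridBd₂, Matrix.dotProduct_mulVec, dotProduct_single_one] at h
      rw [Matrix.mulVec_transpose]
      exact h
    · rintro ⟨s, hs⟩
      have h := dualLine_dotProduct (ξ := ξ) (fstCycle 0)
      rw [periods_fstCycle, ← hs, Matrix.mulVec_transpose, ← Matrix.dotProduct_mulVec,
        gridBd₁_fstCycle, dotProduct_zero] at h
      exact zero_ne_one h
  refine ⟨⟨dualLine, hmem, le_antisymm ?_ (le_of_nontrivial_dual_cycle ⟨_, hmem, rfl⟩)⟩,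
    le_of_nontrivial_dual_cycle⟩
  have hsub : (Finset.univ.filter fun e : Cell ξ × Fin 3 => dualLine e ≠ 0) ⊆
      (Finset.univ : Finset (ZMod ξ)).image fun i => ((i, 0), 2) := by
    rintro ⟨⟨i, j⟩, k⟩ h
    simp only [dualLine, Finset.mem_filter, Finset.mem_univ, true_and, ne_eq, ite_eq_right_iff,
      one_ne_zero, imp_false, not_not] at h
    simp [h.1, h.2]
  calc hammingNorm (dualLine (ξ := ξ))
      = (Finset.univ.filter fun e : Cell ξ × Fin 3 => dualLine e ≠ 0).card := rfl
    _ ≤ _ := Finset.card_le_card hsub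
    _ ≤ (Finset.univ : Finset (ZMod ξ)).card := Finset.card_image_le
    _ = ξ := by rw [Finset.card_univ, ZMod.card]

end Grid

/-! ### Lattice coordinates for the geometric tessellation -/

theorem unit60_eq : unit60 = ((1 / 2 : ℝ) : ℂ) + ((Real.sqrt 3 / 2 : ℝ) : ℂ) * Complex.I := by
  rw [unit60, Complex.exp_mul_I, ← Complex.ofReal_cos, ← Complex.ofReal_sin, Real.cos_pi_div_three,
    Real.sin_pi_div_three]

theorem ofReal_sqrt_three_sq : (Real.sqrt 3 : ℂ) ^ 2 = 3 := by
  have : Real.sqrt 3 ^ 2 = 3 := Real.sq_sqrt (by norm_num)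
  exact_mod_cast this

theorem unit60_sq : unit60 ^ 2 = unit60 - 1 := by
  rw [unit60_eq]
  push_cast
  linear_combination (1 / 4 : ℂ) * (Complex.I ^ 2) * ofReal_sqrt_three_sq +
    (3 / 4 : ℂ) * Complex.I_sq

theorem corner_eq (a : ℝ) (c : ℂ) (k : ℕ) :
    corner a c k = c + ((2 * a / 3 : ℝ) : ℂ) * (1 + unit60) * unit60 ^ k := by
  have h1 : Complex.exp ((Real.pi / 6 + k * (Real.pi / 3) : ℝ) * Complex.I) =
      Complex.exp ((Real.pi / 6 : ℝ) * Complex.I) * unit60 ^ k := by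
    rw [unit60, ← Complex.exp_nat_mul, ← Complex.exp_add]
    congr 1
    push_cast
    ring
  have h2 : Complex.exp ((Real.pi / 6 : ℝ) * Complex.I) =
      ((Real.sqrt 3 / 2 : ℝ) : ℂ) + ((1 / 2 : ℝ) : ℂ) * Complex.I := by
    rw [Complex.exp_mul_I, ← Complex.ofReal_cos, ← Complex.ofReal_sin, Real.cos_pi_div_six,
      Real.sin_pi_div_six]
  have h3 : (Real.sqrt 3 : ℂ) ≠ 0 := by
    intro h
    have := ofReal_sqrt_three_sq
    rw [h] at this
    norm_num at this
  have h4 : ((2 * a / Real.sqrt 3 : ℝ) : ℂ) * Complex.exp ((Real.pi / 6 : ℝ) * Complex.I) =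
      ((2 * a / 3 : ℝ) : ℂ) * (1 + unit60) := by
    rw [h2, unit60_eq]
    push_cast
    field_simp
    linear_combination -(a * Complex.I) * ofReal_sqrt_three_sq
  rw [corner, h1, ← mul_assoc, h4]

/-- The point with coordinates `(m, n)` in the lattice generated by the centres and the vertices. -/
def latticePoint (a : ℝ) (m n : ℤ) : ℂ := ((2 * a / 3 : ℝ) : ℂ) * (m + n * unit60)

theorem latticePoint_inj {a : ℝ} (ha : 0 < a) {m n m' n' : ℤ}
    (h : latticePoint a m n = latticePoint a m' n') : m = m' ∧ n = n' := by
  have hne : ((2 * a / 3 : ℝ) : ℂ) ≠ 0 := by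
    rw [Complex.ofReal_ne_zero]
    positivity
  have h1 := mul_left_cancel₀ hne h
  have h2 := congrArg Complex.im h1
  have h3 := congrArg Complex.re h1
  have h4 : Real.sqrt 3 ≠ 0 := by positivity
  rw [unit60_eq] at h2 h3
  simp at h2 h3
  subst h2
  simpa using h3

/-- The centre of a hexagon in lattice coordinates. -/
def centre (a : ℝ) (p : ℤ × ℤ) : ℂ := latticePoint a (3 * p.1) (3 * p.2)

/-- The vertices of the first kind: the corner at angle `π / 6` of the hexagon `p`. -/
def vertexA (a : ℝ) (p : ℤ × ℤ) : ℂ := latticePoint a (3 * p.1 + 1) (3 * p.2 + 1)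

/-- The vertices of the second kind: the corner at angle `π / 2` of the hexagon `p`. -/
def vertexB (a : ℝ) (p : ℤ × ℤ) : ℂ := latticePoint a (3 * p.1 - 1) (3 * p.2 + 2)

theorem centre_add (a : ℝ) (p q : ℤ × ℤ) : centre a (p + q) = centre a p + centre a q := by
  simp only [centre, latticePoint, Prod.fst_add, Prod.snd_add]
  push_cast
  ring

theorem centre_add_vertexA (a : ℝ) (p q : ℤ × ℤ) :
    centre a p + vertexA a q = vertexA a (q + p) := by
  simp only [centre, vertexA, latticePoint, Prod.fst_add, Prod.snd_add]
  push_cast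
  ring

theorem centre_add_vertexB (a : ℝ) (p q : ℤ × ℤ) :
    centre a p + vertexB a q = vertexB a (q + p) := by
  simp only [centre, vertexB, latticePoint, Prod.fst_add, Prod.snd_add]
  push_cast
  ring

theorem mem_centres_iff {a : ℝ} {c : ℂ} : c ∈ centres a ↔ ∃ p, c = centre a p := by
  rw [centres, AddSubgroup.mem_closure_pair]
  constructor
  · rintro ⟨i, j, rfl⟩
    refine ⟨(i, j), ?_⟩
    simp only [centre, latticePoint, zsmul_eq_mul]
    push_cast
    ring
  · rintro ⟨⟨i, j⟩, rfl⟩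
    refine ⟨i, j, ?_⟩
    simp only [centre, latticePoint, zsmul_eq_mul]
    push_cast
    ring

theorem mem_lattice_iff {a : ℝ} {ξ : ℕ} {t : ℂ} :
    t ∈ lattice a ξ ↔ ∃ p : ℤ × ℤ, t = centre a ((ξ : ℤ) • p) := by
  rw [lattice, torusLattice, AddSubgroup.mem_closure_pair]
  constructor
  · rintro ⟨i, j, rfl⟩
    refine ⟨(i, j), ?_⟩
    simp only [centre, latticePoint, Prod.smul_fst, Prod.smul_snd, smul_eq_mul]
    rw [zsmul_eq_mul, zsmul_eq_mul]
    push_cast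
    ring
  · rintro ⟨⟨i, j⟩, rfl⟩
    refine ⟨i, j, ?_⟩
    simp only [centre, latticePoint, Prod.smul_fst, Prod.smul_snd, smul_eq_mul]
    rw [zsmul_eq_mul, zsmul_eq_mul]
    push_cast
    ring

theorem centre_mem_centres (a : ℝ) (p : ℤ × ℤ) : centre a p ∈ centres a :=
  mem_centres_iff.2 ⟨p, rfl⟩

theorem centre_inj {a : ℝ} (ha : 0 < a) {p q : ℤ × ℤ} (h : centre a p = centre a q) : p = q := by
  obtain ⟨h1, h2⟩ := latticePoint_inj ha h
  ext <;> omega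

theorem vertexA_inj {a : ℝ} (ha : 0 < a) {p q : ℤ × ℤ} (h : vertexA a p = vertexA a q) :
    p = q := by
  obtain ⟨h1, h2⟩ := latticePoint_inj ha h
  ext <;> omega

theorem vertexB_inj {a : ℝ} (ha : 0 < a) {p q : ℤ × ℤ} (h : vertexB a p = vertexB a q) :
    p = q := by
  obtain ⟨h1, h2⟩ := latticePoint_inj ha h
  ext <;> omega

/-- The two kinds have first coordinates `1` and `-1` mod 3. -/
theorem vertexA_ne_vertexB {a : ℝ} (ha : 0 < a) (p q : ℤ × ℤ) : vertexA a p ≠ vertexB a q := by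
  intro h
  obtain ⟨h1, h2⟩ := latticePoint_inj ha h
  omega

/-! ### Corners and sides of a hexagon in lattice coordinates -/

section Corners

variable (a : ℝ) (p : ℤ × ℤ)

theorem corner_zero : corner a (centre a p) 0 = vertexA a p := by
  rw [corner_eq]
  simp only [centre, vertexA, latticePoint]
  push_cast
  ring

theorem corner_one : corner a (centre a p) 1 = vertexB a p := by
  rw [corner_eq]
  simp only [centre, vertexB, latticePoint]
  push_cast
  linear_combination (2 * (a : ℂ) / 3) * unit60_sq

/-- The relation `ω² = ω - 1` for the sixth root of unity yields a recursion for all corners from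
the first two. -/
theorem corner_add_two (c : ℂ) (k : ℕ) :
    corner a c (k + 2) = corner a c (k + 1) - corner a c k + c := by
  simp only [corner_eq, pow_add]
  linear_combination ((2 * a / 3 : ℝ) : ℂ) * (1 + unit60) * unit60 ^ k * unit60_sq

theorem corner_two : corner a (centre a p) 2 = vertexA a (p + (-1, 0)) := by
  rw [corner_add_two, corner_zero, corner_one]
  simp only [centre, vertexA, vertexB, latticePoint, Prod.fst_add, Prod.snd_add]
  push_cast
  ring

theorem corner_three : corner a (centre a p) 3 = vertexB a (p + (0, -1)) := by
  rw [corner_add_two, corner_two, corner_one]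
  simp only [centre, vertexA, vertexB, latticePoint, Prod.fst_add, Prod.snd_add]
  push_cast
  ring

theorem corner_four : corner a (centre a p) 4 = vertexA a (p + (0, -1)) := by
  rw [corner_add_two, corner_three, corner_two]
  simp only [centre, vertexA, vertexB, latticePoint, Prod.fst_add, Prod.snd_add]
  push_cast
  ring

theorem corner_five : corner a (centre a p) 5 = vertexB a (p + (1, -1)) := by
  rw [corner_add_two, corner_four, corner_three]
  simp only [centre, vertexA, vertexB, latticePoint, Prod.fst_add, Prod.snd_add]
  push_cast
  ring

theorem corner_six : corner a (centre a p) 6 = vertexA a p := by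
  rw [corner_add_two, corner_five, corner_four]
  simp only [centre, vertexA, vertexB, latticePoint, Prod.fst_add, Prod.snd_add]
  push_cast
  ring

theorem exists_vertex_eq_corner (k : Fin 6) :
    ∃ q, corner a (centre a p) k = vertexA a q ∨ corner a (centre a p) k = vertexB a q := by
  fin_cases k
  · exact ⟨_, Or.inl (corner_zero a p)⟩
  · exact ⟨_, Or.inr (corner_one a p)⟩
  · exact ⟨_, Or.inl (corner_two a p)⟩
  · exact ⟨_, Or.inr (corner_three a p)⟩
  · exact ⟨_, Or.inl (corner_four a p)⟩
  · exact ⟨_, Or.inr (corner_five a p)⟩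

/-- The edge `(p, k)` of the plane. -/
def planeEdge (k : Fin 3) : Sym2 ℂ := s(vertexA a p, vertexB a (p + edgeOffset k))

/-- The `k`-th side of the hexagon `p` is the edge `(p + sideOffset k, sideKind k)`. -/
def sideOffset {R : Type*} [Ring R] : Fin 6 → R × R :=
  ![(0, 0), (-1, 0), (-1, 0), (0, -1), (0, -1), (0, 0)]

/-- The direction of the `k`-th side of a hexagon. -/
def sideKind : Fin 6 → Fin 3 := ![0, 1, 2, 0, 1, 2]

theorem hexSide_centre (k : Fin 6) :
    hexSide a (centre a p) k = planeEdge a (p + sideOffset k) (sideKind k) := by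
  fin_cases k
  · simp only [hexSide, planeEdge]
    refine (congrArg₂ _ (corner_zero a p) (corner_one a p)).trans ?_
    simp [sideOffset, sideKind, edgeOffset, Prod.mk_zero_zero]
  · simp only [hexSide, planeEdge]
    refine (congrArg₂ _ (corner_one a p) (corner_two a p)).trans ?_
    rw [Sym2.eq_swap]
    simp [sideOffset, sideKind, edgeOffset, add_assoc, Prod.mk_zero_zero]
  · simp only [hexSide, planeEdge]
    refine (congrArg₂ _ (corner_two a p) (corner_three a p)).trans ?_
    simp [sideOffset, sideKind, edgeOffset, add_assoc, Prod.mk_zero_zero]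
  · simp only [hexSide, planeEdge]
    refine (congrArg₂ _ (corner_three a p) (corner_four a p)).trans ?_
    rw [Sym2.eq_swap]
    simp [sideOffset, sideKind, edgeOffset, Prod.mk_zero_zero]
  · simp only [hexSide, planeEdge]
    refine (congrArg₂ _ (corner_four a p) (corner_five a p)).trans ?_
    simp [sideOffset, sideKind, edgeOffset, add_assoc, Prod.mk_zero_zero]
  · simp only [hexSide, planeEdge]
    refine (congrArg₂ _ (corner_five a p) (corner_six a p)).trans ?_
    rw [Sym2.eq_swap]
    simp [sideOffset, sideKind, edgeOffset, Prod.mk_zero_zero]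

theorem planeEdge_eq_hexSide (k : Fin 3) :
    ∃ c ∈ centres a, ∃ l : Fin 6, planeEdge a p k = hexSide a c l := by
  have h : ∀ l : Fin 6, ∃ c ∈ centres a, ∃ l' : Fin 6,
      planeEdge a p (sideKind l) = hexSide a c l' :=
    fun l => ⟨centre a (p - sideOffset l), centre_mem_centres _ _, l, by
      rw [hexSide_centre, sub_add_cancel]⟩
  fin_cases k
  · exact h 0
  · exact h 1
  · exact h 2

theorem map_planeEdge (q : ℤ × ℤ) (k : Fin 3) :
    (planeEdge a p k).map (centre a q + ·) = planeEdge a (p + q) k := by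
  simp only [planeEdge, Sym2.map_mk, centre_add_vertexA, centre_add_vertexB]
  rw [add_right_comm]

theorem planeEdge_inj {a : ℝ} (ha : 0 < a) {p q : ℤ × ℤ} {k l : Fin 3}
    (h : planeEdge a p k = planeEdge a q l) : p = q ∧ k = l := by
  rw [planeEdge, planeEdge, Sym2.eq_iff] at h
  rcases h with ⟨h1, h2⟩ | ⟨h1, -⟩
  · have h3 := vertexA_inj ha h1
    have h4 := vertexB_inj ha h2
    subst h3
    refine ⟨rfl, ?_⟩
    have h5 := add_left_cancel h4
    revert h5
    clear h1 h2 h4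
    revert k l
    decide
  · exact absurd h1 (vertexA_ne_vertexB ha _ _)

end Corners

/-! ### The tessellation of the torus in lattice coordinates -/

/-- Reduction of lattice coordinates to the torus. -/
def toCell (ξ : ℕ) : ℤ × ℤ →+ Cell ξ :=
  AddMonoidHom.prodMap (Int.castAddHom (ZMod ξ)) (Int.castAddHom (ZMod ξ))

theorem toCell_surjective (ξ : ℕ) : Function.Surjective (toCell ξ) :=
  Function.Surjective.prodMap ZMod.intCast_surjective ZMod.intCast_surjective

theorem toCell_eq_iff {ξ : ℕ} {p q : ℤ × ℤ} :
    toCell ξ p = toCell ξ q ↔ ∃ r : ℤ × ℤ, q = p + (ξ : ℤ) • r := by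
  have h : toCell ξ p = toCell ξ q ↔
      (ξ : ℤ) ∣ q.1 - p.1 ∧ (ξ : ℤ) ∣ q.2 - p.2 := by
    rw [← ZMod.intCast_eq_intCast_iff_dvd_sub, ← ZMod.intCast_eq_intCast_iff_dvd_sub]
    exact Prod.ext_iff
  rw [h]
  constructor
  · rintro ⟨⟨i, hi⟩, ⟨j, hj⟩⟩
    refine ⟨(i, j), Prod.ext ?_ ?_⟩
    · simp only [Prod.fst_add, Prod.smul_fst, smul_eq_mul]; omega
    · simp only [Prod.snd_add, Prod.smul_snd, smul_eq_mul]; omega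
  · rintro ⟨r, rfl⟩
    simp

/-- A lift of a cell of the torus to the plane. -/
def Cell.lift {ξ : ℕ} (c : Cell ξ) : ℤ × ℤ := Function.surjInv (toCell_surjective ξ) c

theorem toCell_lift {ξ : ℕ} (c : Cell ξ) : toCell ξ c.lift = c :=
  Function.surjInv_eq (toCell_surjective ξ) c

theorem toCell_edgeOffset (ξ : ℕ) (k : Fin 3) : toCell ξ (edgeOffset k) = edgeOffset k := by
  fin_cases k <;> simp [toCell, edgeOffset]

theorem toCell_sideOffset (ξ : ℕ) (k : Fin 6) : toCell ξ (sideOffset k) = sideOffset k := by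
  fin_cases k <;> simp [toCell, sideOffset]

section Torus

variable (a : ℝ) (ξ : ℕ)

/-- The edge of the torus covered by the edge `(p, k)` of the plane. -/
def mkEdge (p : ℤ × ℤ) (k : Fin 3) : TorusEdge a ξ :=
  Quotient.mk (edgeSetoid a ξ) ⟨planeEdge a p k, planeEdge_eq_hexSide a p k⟩

/-- The face of the torus covered by the hexagon `p`. -/
def mkFace (p : ℤ × ℤ) : TorusFace a ξ :=
  QuotientAddGroup.mk (⟨centre a p, centre_mem_centres a p⟩ : centres a)

/-- The vertex of the torus covered by the vertex `p` of the first kind. -/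
def mkVertexA (p : ℤ × ℤ) : TorusVertex a ξ :=
  ⟨(vertexA a p : ℂ), centre a p, centre_mem_centres a p, 0, by rw [← corner_zero]; rfl⟩

/-- The vertex of the torus covered by the vertex `p` of the second kind. -/
def mkVertexB (p : ℤ × ℤ) : TorusVertex a ξ :=
  ⟨(vertexB a p : ℂ), centre a p, centre_mem_centres a p, 1, by rw [← corner_one]; rfl⟩

variable {a ξ}

theorem mkEdge_eq_iff (ha : 0 < a) {p q : ℤ × ℤ} {k l : Fin 3} :
    mkEdge a ξ p k = mkEdge a ξ q l ↔ toCell ξ p = toCell ξ q ∧ k = l := by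
  have h : mkEdge a ξ p k = mkEdge a ξ q l ↔
      ∃ t ∈ lattice a ξ, planeEdge a q l = (planeEdge a p k).map (t + ·) := Quotient.eq
  rw [h, toCell_eq_iff]
  constructor
  · rintro ⟨t, ht, h⟩
    obtain ⟨r, rfl⟩ := mem_lattice_iff.1 ht
    rw [map_planeEdge] at h
    obtain ⟨h1, h2⟩ := planeEdge_inj ha h
    exact ⟨⟨r, h1⟩, h2.symm⟩
  · rintro ⟨⟨r, rfl⟩, rfl⟩
    exact ⟨_, mem_lattice_iff.2 ⟨r, rfl⟩, (map_planeEdge a p _ k).symm⟩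

theorem exists_eq_mkEdge (e : TorusEdge a ξ) : ∃ p k, e = mkEdge a ξ p k := by
  induction e using Quotient.inductionOn with
  | h e =>
    obtain ⟨e, c, hc, k, rfl⟩ := e
    obtain ⟨p, rfl⟩ := mem_centres_iff.1 hc
    exact ⟨_, _, congrArg _ (Subtype.ext (hexSide_centre a p k))⟩

theorem torusSide_centre (p : ℤ × ℤ) (k : Fin 6) :
    torusSide a ξ ⟨centre a p, centre_mem_centres a p⟩ k =
      mkEdge a ξ (p + sideOffset k) (sideKind k) :=
  congrArg _ (Subtype.ext (hexSide_centre a p k))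

theorem exists_out_mkEdge (p : ℤ × ℤ) (k : Fin 3) :
    ∃ q, toCell ξ q = toCell ξ p ∧ (Quotient.out (mkEdge a ξ p k)).1 = planeEdge a q k := by
  obtain ⟨t, ht, h⟩ := Quotient.exact (Quotient.out_eq (mkEdge a ξ p k)).symm
  obtain ⟨r, rfl⟩ := mem_lattice_iff.1 ht
  refine ⟨p + (ξ : ℤ) • r, (toCell_eq_iff.2 ⟨r, rfl⟩).symm, ?_⟩
  rw [← map_planeEdge]
  exact h

theorem centre_sub_mem_lattice_iff (ha : 0 < a) {p q : ℤ × ℤ} :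
    -centre a p + centre a q ∈ lattice a ξ ↔ toCell ξ p = toCell ξ q := by
  rw [mem_lattice_iff, toCell_eq_iff]
  refine exists_congr fun r => ?_
  rw [neg_add_eq_iff_eq_add, ← centre_add]
  exact ⟨fun h => centre_inj ha h, fun h => by rw [h]⟩

theorem mkFace_eq_iff (ha : 0 < a) {p q : ℤ × ℤ} :
    mkFace a ξ p = mkFace a ξ q ↔ toCell ξ p = toCell ξ q := by
  rw [← centre_sub_mem_lattice_iff ha]
  exact QuotientAddGroup.eq.trans AddSubgroup.mem_addSubgroupOf

theorem exists_out_eq_centre (f : TorusFace a ξ) :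
    ∃ p, (Quotient.out f : centres a) = ⟨centre a p, centre_mem_centres a p⟩ ∧
      f = mkFace a ξ p := by
  obtain ⟨p, hp⟩ := mem_centres_iff.1 (Quotient.out f : centres a).2
  have h : (Quotient.out f : centres a) = ⟨centre a p, centre_mem_centres a p⟩ := Subtype.ext hp
  refine ⟨p, h, ?_⟩
  rw [mkFace, ← h]
  exact (Quotient.out_eq f).symm

theorem vertexA_eq_iff (ha : 0 < a) {p q : ℤ × ℤ} :
    (vertexA a p : ℂ ⧸ lattice a ξ) = (vertexA a q : ℂ) ↔ toCell ξ p = toCell ξ q := by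
  rw [← centre_sub_mem_lattice_iff ha, QuotientAddGroup.eq]
  have : -vertexA a p + vertexA a q = -centre a p + centre a q := by
    simp only [centre, vertexA, latticePoint]
    push_cast
    ring
  rw [this]

theorem vertexB_eq_iff (ha : 0 < a) {p q : ℤ × ℤ} :
    (vertexB a p : ℂ ⧸ lattice a ξ) = (vertexB a q : ℂ) ↔ toCell ξ p = toCell ξ q := by
  rw [← centre_sub_mem_lattice_iff ha, QuotientAddGroup.eq]
  have : -vertexB a p + vertexB a q = -centre a p + centre a q := by
    simp only [centre, vertexB, latticePoint]
    push_cast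
    ring
  rw [this]

theorem mk_vertexA_ne_mk_vertexB (ha : 0 < a) (p q : ℤ × ℤ) :
    (vertexA a p : ℂ ⧸ lattice a ξ) ≠ (vertexB a q : ℂ) := by
  intro h
  rw [QuotientAddGroup.eq, mem_lattice_iff] at h
  obtain ⟨r, hr⟩ := h
  rw [neg_add_eq_iff_eq_add, add_comm, centre_add_vertexA] at hr
  exact vertexA_ne_vertexB ha _ _ hr.symm

theorem exists_eq_mkVertex (v : TorusVertex a ξ) :
    ∃ p, v = mkVertexA a ξ p ∨ v = mkVertexB a ξ p := by
  obtain ⟨_, c, hc, k, rfl⟩ := v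
  obtain ⟨p, rfl⟩ := mem_centres_iff.1 hc
  obtain ⟨q, h | h⟩ := exists_vertex_eq_corner a p k
  · exact ⟨q, Or.inl (Subtype.ext (congrArg (QuotientAddGroup.mk (s := lattice a ξ)) h))⟩
  · exact ⟨q, Or.inr (Subtype.ext (congrArg (QuotientAddGroup.mk (s := lattice a ξ)) h))⟩

/-- The edges of the torus in lattice coordinates. -/
def edgeEquiv (ha : 0 < a) : Cell ξ × Fin 3 ≃ TorusEdge a ξ :=
  Equiv.ofBijective (fun e => mkEdge a ξ e.1.lift e.2) <| by
    constructor
    · rintro ⟨c, k⟩ ⟨d, l⟩ h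
      obtain ⟨h1, h2⟩ := (mkEdge_eq_iff ha).1 h
      rw [toCell_lift, toCell_lift] at h1
      exact Prod.ext h1 h2
    · intro e
      obtain ⟨p, k, rfl⟩ := exists_eq_mkEdge e
      exact ⟨(toCell ξ p, k), (mkEdge_eq_iff ha).2 ⟨toCell_lift _, rfl⟩⟩

theorem edgeEquiv_toCell (ha : 0 < a) (p : ℤ × ℤ) (k : Fin 3) :
    edgeEquiv ha (toCell ξ p, k) = mkEdge a ξ p k :=
  (mkEdge_eq_iff ha).2 ⟨toCell_lift _, rfl⟩

/-- The faces of the torus in lattice coordinates. -/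
def faceEquiv (ha : 0 < a) : Cell ξ ≃ TorusFace a ξ :=
  Equiv.ofBijective (fun c => mkFace a ξ c.lift) <| by
    constructor
    · intro c d h
      have h1 := (mkFace_eq_iff ha).1 h
      rwa [toCell_lift, toCell_lift] at h1
    · intro f
      obtain ⟨p, -, rfl⟩ := exists_out_eq_centre f
      exact ⟨toCell ξ p, (mkFace_eq_iff ha).2 (toCell_lift _)⟩

/-- The vertices of the torus in lattice coordinates. -/
def vertexEquiv (ha : 0 < a) : Cell ξ ⊕ Cell ξ ≃ TorusVertex a ξ :=
  Equiv.ofBijective (Sum.elim (fun c => mkVertexA a ξ c.lift) fun c => mkVertexB a ξ c.lift) <| by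
    constructor
    · rintro (c | c) (d | d) h
      · have h1 := (vertexA_eq_iff ha).1 (congrArg Subtype.val h)
        rw [toCell_lift, toCell_lift] at h1
        rw [h1]
      · exact absurd (congrArg Subtype.val h) (mk_vertexA_ne_mk_vertexB ha _ _)
      · exact absurd (congrArg Subtype.val h).symm (mk_vertexA_ne_mk_vertexB ha _ _)
      · have h1 := (vertexB_eq_iff ha).1 (congrArg Subtype.val h)
        rw [toCell_lift, toCell_lift] at h1
        rw [h1]
    · intro v
      obtain ⟨p, rfl | rfl⟩ := exists_eq_mkVertex v
      · exact ⟨Sum.inl (toCell ξ p), Subtype.ext ((vertexA_eq_iff ha).2 (toCell_lift _))⟩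
      · exact ⟨Sum.inr (toCell ξ p), Subtype.ext ((vertexB_eq_iff ha).2 (toCell_lift _))⟩

theorem boundary₂_eq (ha : 0 < a) :
    boundary₂ a ξ = (gridBd₂ ξ).submatrix (edgeEquiv ha).symm (faceEquiv ha).symm := by
  ext e f
  obtain ⟨⟨c, k⟩, rfl⟩ := (edgeEquiv ha).surjective e
  obtain ⟨d, rfl⟩ := (faceEquiv ha).surjective f
  obtain ⟨p, hout, hf⟩ := exists_out_eq_centre (faceEquiv ha d)
  have hd : toCell ξ p = d := by
    have h := (mkFace_eq_iff ha).1 hf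
    rw [← h, toCell_lift]
  have hside : ∀ k' : Fin 6, torusSide a ξ (Quotient.out (faceEquiv ha d)) k' =
      edgeEquiv ha (c, k) ↔ (c = d + sideOffset k' ∧ k = sideKind k') := by
    intro k'
    rw [hout, torusSide_centre, ← edgeEquiv_toCell ha, (edgeEquiv ha).injective.eq_iff,
      map_add, toCell_sideOffset, hd, Prod.mk.injEq, eq_comm, eq_comm (a := sideKind k')]
  have hc : ∀ x : Cell ξ, c + x = d ↔ c = d + -x := fun x => by
    rw [← sub_eq_add_neg, eq_sub_iff_add_eq]
  simp only [boundary₂, Matrix.of_apply, hside, Matrix.submatrix_apply, Equiv.symm_apply_apply,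
    gridBd₂, hc, Finset.card_filter, Fin.sum_univ_six]
  -- Each kind occurs on two of the six sides, giving the two indicators. For `ξ = 1` they coincide
  -- and cancel mod 2 on both sides.
  fin_cases k <;> simp [sideOffset, sideKind, faceOffset, faceOffset', add_comm]

/-- The ends of an edge have different kinds, which lattice translations preserve. So at most one
end lies over a given vertex, even for `ξ = 1`. -/
theorem boundary₁_eq (ha : 0 < a) :
    boundary₁ a ξ = (gridBd₁ ξ).submatrix (vertexEquiv ha).symm (edgeEquiv ha).symm := by
  ext v e
  obtain ⟨⟨c, k⟩, rfl⟩ := (edgeEquiv ha).surjective e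
  obtain ⟨v, rfl⟩ := (vertexEquiv ha).surjective v
  obtain ⟨q, hq, hout⟩ := exists_out_mkEdge (a := a) (ξ := ξ) c.lift k
  rw [toCell_lift] at hq
  have hA : ∀ d : Cell ξ, ((vertexA a q : ℂ) : ℂ ⧸ lattice a ξ) =
      (vertexEquiv ha (Sum.inl d)).1 ↔ c = d := fun d => by
    have h := vertexA_eq_iff (ξ := ξ) ha (p := q) (q := d.lift)
    rwa [hq, toCell_lift] at h
  have hB : ∀ d : Cell ξ, ((vertexB a (q + edgeOffset k) : ℂ) : ℂ ⧸ lattice a ξ) =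
      (vertexEquiv ha (Sum.inr d)).1 ↔ c + edgeOffset k = d := fun d => by
    have h := vertexB_eq_iff (ξ := ξ) ha (p := q + edgeOffset k) (q := d.lift)
    rwa [map_add, toCell_edgeOffset, hq, toCell_lift] at h
  have hAB : ∀ d : Cell ξ, ((vertexA a q : ℂ) : ℂ ⧸ lattice a ξ) ≠
      (vertexEquiv ha (Sum.inr d)).1 := fun d => mk_vertexA_ne_mk_vertexB ha _ _
  have hBA : ∀ d : Cell ξ, ((vertexB a (q + edgeOffset k) : ℂ) : ℂ ⧸ lattice a ξ) ≠
      (vertexEquiv ha (Sum.inl d)).1 := fun d => (mk_vertexA_ne_mk_vertexB ha _ _).symm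
  have hset : {z : ℂ | z ∈ (Quotient.out (edgeEquiv ha (c, k))).1 ∧
      (z : ℂ ⧸ lattice a ξ) = (vertexEquiv ha v).1} =
      {z | (z = vertexA a q ∨ z = vertexB a (q + edgeOffset k)) ∧
        (z : ℂ ⧸ lattice a ξ) = (vertexEquiv ha v).1} := by
    ext z
    have h : z ∈ (Quotient.out (edgeEquiv ha (c, k))).1 ↔
        z = vertexA a q ∨ z = vertexB a (q + edgeOffset k) := by
      have h1 : (Quotient.out (edgeEquiv ha (c, k))).1 = planeEdge a q k := hout
      rw [h1, planeEdge, Sym2.mem_iff]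
    simp only [Set.mem_ofPred_eq, h]
  simp only [boundary₁, Matrix.of_apply, hset, Matrix.submatrix_apply, Equiv.symm_apply_apply,
    gridBd₁]
  rcases v with d | d
  · simp only [Sum.elim_inl]
    split_ifs with h
    · rw [show {z | (z = vertexA a q ∨ z = vertexB a (q + edgeOffset k)) ∧
        (z : ℂ ⧸ lattice a ξ) = (vertexEquiv ha (Sum.inl d)).1} = {vertexA a q} from ?_]
      · simp
      · ext z
        constructor
        · rintro ⟨rfl | rfl, hz⟩
          · rfl
          · exact absurd hz (hBA d)
        · rintro rfl
          exact ⟨Or.inl rfl, (hA d).2 h⟩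
    · rw [show {z | (z = vertexA a q ∨ z = vertexB a (q + edgeOffset k)) ∧
        (z : ℂ ⧸ lattice a ξ) = (vertexEquiv ha (Sum.inl d)).1} = ∅ from ?_]
      · simp
      · refine Set.eq_empty_of_forall_notMem ?_
        rintro z ⟨rfl | rfl, hz⟩
        · exact h ((hA d).1 hz)
        · exact hBA d hz
  · simp only [Sum.elim_inr]
    split_ifs with h
    · rw [show {z | (z = vertexA a q ∨ z = vertexB a (q + edgeOffset k)) ∧
        (z : ℂ ⧸ lattice a ξ) = (vertexEquiv ha (Sum.inr d)).1} =
          {vertexB a (q + edgeOffset k)} from ?_]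
      · simp
      · ext z
        constructor
        · rintro ⟨rfl | rfl, hz⟩
          · exact absurd hz (hAB d)
          · rfl
        · rintro rfl
          exact ⟨Or.inr rfl, (hB d).2 h⟩
    · rw [show {z | (z = vertexA a q ∨ z = vertexB a (q + edgeOffset k)) ∧
        (z : ℂ ⧸ lattice a ξ) = (vertexEquiv ha (Sum.inr d)).1} = ∅ from ?_]
      · simp
      · refine Set.eq_empty_of_forall_notMem ?_
        rintro z ⟨rfl | rfl, hz⟩
        · exact hAB d hz
        · exact h ((hB d).1 hz)

end Torus

/-! ### Transport along the coordinates -/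

section Transport

variable {V E F V' E' F' : Type} [Fintype E] [Fintype F] [Fintype E'] [Fintype F']

theorem nontrivialCycleLengths_submatrix (M : Matrix V E (ZMod 2)) (N : Matrix E F (ZMod 2))
    (v : V' ≃ V) (e : E' ≃ E) (f : F' ≃ F) :
    nontrivialCycleLengths (M.submatrix v e) (N.submatrix e f) = nontrivialCycleLengths M N := by
  have hnorm : ∀ z : E → ZMod 2, hammingNorm (z ∘ e) = hammingNorm z := fun z =>
    Finset.card_equiv e (by simp)
  have hmem : ∀ z : E → ZMod 2, z ∘ e ∈ nontrivialCycles (M.submatrix v e) (N.submatrix e f) ↔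
      z ∈ nontrivialCycles M N := by
    intro z
    have h1 : (z ∘ e) ∘ e.symm = z := by ext; simp
    have h2 : (M.submatrix v e).mulVec (z ∘ e) = 0 ↔ M.mulVec z = 0 := by
      rw [Matrix.submatrix_mulVec_equiv, h1]
      exact ⟨fun h => v.surjective.injective_comp_right h, fun h => by rw [h]; rfl⟩
    have h3 : (∃ s, (N.submatrix e f).mulVec s = z ∘ e) ↔ ∃ s, N.mulVec s = z := by
      constructor
      · rintro ⟨s, hs⟩
        rw [Matrix.submatrix_mulVec_equiv] at hs
        exact ⟨_, e.surjective.injective_comp_right hs⟩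
      · rintro ⟨s, rfl⟩
        refine ⟨s ∘ f, ?_⟩
        rw [Matrix.submatrix_mulVec_equiv]
        congr 2
        ext; simp
    exact and_congr h2 (not_congr h3)
  ext n
  constructor
  · rintro ⟨z, hz, rfl⟩
    have h1 : (z ∘ e.symm) ∘ e = z := by ext; simp
    rw [← h1] at hz ⊢
    exact ⟨_, (hmem _).1 hz, (hnorm _).symm⟩
  · rintro ⟨z, hz, rfl⟩
    exact ⟨_, (hmem z).2 hz, hnorm z⟩

end Transport

/-- Reduces the claimed bound for hexagonal cycles to the stronger `2ξ`. -/
theorem ceil_mul_sqrt_three_le (ξ : ℕ) : ⌈(ξ : ℝ) * Real.sqrt 3⌉₊ ≤ 2 * ξ := by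
  rw [Nat.ceil_le]
  have h : Real.sqrt 3 ≤ 2 := by
    rw [Real.sqrt_le_left (by norm_num)]
    norm_num
  push_cast
  nlinarith [(Nat.cast_nonneg ξ : (0 : ℝ) ≤ ξ)]

/-! ### Transfer of homology and lengths to the geometric torus -/

section Torus

variable {a : ℝ} {ξ : ℕ} [NeZero ξ]

theorem isLeast_dualCycleLengths (ha : 0 < a) :
    IsLeast (nontrivialCycleLengths (boundary₂ a ξ).transpose (boundary₁ a ξ).transpose) ξ := by
  rw [boundary₁_eq ha, boundary₂_eq ha, Matrix.transpose_submatrix, Matrix.transpose_submatrix,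
    nontrivialCycleLengths_submatrix]
  exact isLeast_dual_cycle_lengths

theorem ceil_mem_lowerBounds_cycleLengths (ha : 0 < a) :
    ⌈(ξ : ℝ) * Real.sqrt 3⌉₊ ∈
      lowerBounds (nontrivialCycleLengths (boundary₁ a ξ) (boundary₂ a ξ)) := by
  rw [boundary₁_eq ha, boundary₂_eq ha, nontrivialCycleLengths_submatrix]
  exact fun n hn => (ceil_mul_sqrt_three_le ξ).trans (two_mul_le_of_nontrivial_cycle hn)

theorem boundary₁_mul_boundary₂ (ha : 0 < a) : boundary₁ a ξ * boundary₂ a ξ = 0 := by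
  rw [boundary₁_eq ha, boundary₂_eq ha, Matrix.submatrix_mul_equiv, gridBd₁_mul_gridBd₂]
  rfl

/-- The periods of a 1-chain of the torus. -/
def torusPeriods (ha : 0 < a) : Label (TorusEdge a ξ) →+ ZMod 2 × ZMod 2 :=
  periods.comp (LinearMap.funLeft (ZMod 2) (ZMod 2) (edgeEquiv (ξ := ξ) ha)).toAddMonoidHom

theorem torusPeriods_apply (ha : 0 < a) (z : Label (TorusEdge a ξ)) :
    torusPeriods ha z = periods (z ∘ edgeEquiv ha) := rfl

theorem boundary₁_mulVec (ha : 0 < a) (z : Label (TorusEdge a ξ)) :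
    (boundary₁ a ξ).mulVec z = 0 ↔ (gridBd₁ ξ).mulVec (z ∘ edgeEquiv ha) = 0 := by
  rw [boundary₁_eq ha, Matrix.submatrix_mulVec_equiv, Equiv.symm_symm]
  exact ⟨fun h => (vertexEquiv ha).symm.surjective.injective_comp_right h,
    fun h => by rw [h]; rfl⟩

theorem exists_boundary₂_mulVec (ha : 0 < a) (z : Label (TorusEdge a ξ)) :
    (∃ s, (boundary₂ a ξ).mulVec s = z) ↔ ∃ s, (gridBd₂ ξ).mulVec s = z ∘ edgeEquiv ha := by
  rw [boundary₂_eq ha]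
  simp only [Matrix.submatrix_mulVec_equiv, Equiv.symm_symm, Equiv.comp_symm_eq]
  constructor
  · rintro ⟨s, hs⟩
    exact ⟨_, hs⟩
  · rintro ⟨s, hs⟩
    refine ⟨s ∘ (faceEquiv ha).symm, ?_⟩
    rw [← hs]
    congr 1
    ext; simp

theorem torusPeriods_eq_zero_iff (ha : 0 < a) {z : Label (TorusEdge a ξ)}
    (hz : (boundary₁ a ξ).mulVec z = 0) :
    torusPeriods ha z = 0 ↔ ∃ s, (boundary₂ a ξ).mulVec s = z := by
  rw [exists_boundary₂_mulVec ha, torusPeriods_apply]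
  constructor
  · exact exists_boundary_of_periods_eq_zero ((boundary₁_mulVec ha z).1 hz)
  · rintro ⟨s, hs⟩
    rw [← hs, periods_gridBd₂]

theorem exists_torusPeriods_eq (ha : 0 < a) (t : ZMod 2 × ZMod 2) :
    ∃ z, (boundary₁ a ξ).mulVec z = 0 ∧ torusPeriods ha z = t := by
  obtain ⟨z, hz, ht⟩ := exists_cycle_with_periods (ξ := ξ) t
  have h : (z ∘ (edgeEquiv ha).symm) ∘ edgeEquiv ha = z := by ext; simp
  refine ⟨z ∘ (edgeEquiv ha).symm, ?_, ?_⟩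
  · rw [boundary₁_mulVec ha, h, hz]
  · rw [torusPeriods_apply, h, ht]

theorem card_torusEdge (ha : 0 < a) : Fintype.card (TorusEdge a ξ) = 3 * ξ ^ 2 := by
  rw [← Fintype.card_congr (edgeEquiv (ξ := ξ) ha)]
  simp only [Fintype.card_prod, ZMod.card, Fintype.card_fin]
  ring

end Torus

end HexTorus

end

theorem corollary1 (ξ : ℕ) [NeZero ξ] (a : ℝ) (ha : 0 < a) :
    HexTorus.IsAsymmetricCode
      (HexTorus.topologicalCode (HexTorus.boundary₁ a ξ) (HexTorus.boundary₂ a ξ))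
      (3 * ξ ^ 2) 2 ξ ⌈(ξ : ℝ) * Real.sqrt 3⌉₊ ∧
    IsLeast (HexTorus.nontrivialCycleLengths
      (HexTorus.boundary₂ a ξ).transpose (HexTorus.boundary₁ a ξ).transpose) ξ ∧
    ⌈(ξ : ℝ) * Real.sqrt 3⌉₊ ∈ lowerBounds (HexTorus.nontrivialCycleLengths
      (HexTorus.boundary₁ a ξ) (HexTorus.boundary₂ a ξ)) := by
  have hξ : 0 < ξ := Nat.pos_of_ne_zero (NeZero.ne ξ)
  refine ⟨?_, HexTorus.isLeast_dualCycleLengths ha, HexTorus.ceil_mem_lowerBounds_cycleLengths ha⟩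
  refine HexTorus.isAsymmetricCode_topologicalCode _ _ (HexTorus.boundary₁_mul_boundary₂ ha)
    (HexTorus.torusPeriods ha) (fun z hz => HexTorus.torusPeriods_eq_zero_iff ha hz)
    (HexTorus.exists_torusPeriods_eq ha) (HexTorus.card_torusEdge ha) (by decide) hξ ?_
    (HexTorus.isLeast_dualCycleLengths ha).2 (HexTorus.ceil_mem_lowerBounds_cycleLengths ha)
  exact Nat.ceil_pos.2 (by positivity)
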